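/- Let $\Bbbk$ be a field of characteristic $0$, let $n\ge 1$, and let $S=\Bbbk[x_1,\dots,x_n]$ with its standard $\mathbb Z^n$-grading. For ${\bf a}\in\mathbb Z^n$ write $|{\bf a}|=\sum_k a_k$. **The equivariant resolution.** For a vector ${\bf e}=(e_1,\dots,e_n)$ of positive integers put $\lambda_j=\sum_{l=j+1}^n(e_l-1)$ and, for $i=0,\dots,n$, $$\alpha({\bf e},i)=(\lambda_1+e_1,\dots,\lambda_i+e_i,\lambda_{i+1},\dots,\lambda_n).$$ Let $E({\bf e})$ be the $GL(n)$-equivariant resolution of Eisenbud, Fløystad and Weyman, $$S\otimes_\Bbbk S_{\alpha({\bf e},0)}\leftarrow S\otimes_\Bbbk S_{\alpha({\bf e},1)}\leftarrow\cdots\leftarrow S\otimes_\Bbbk S_{\alpha({\bf e},n)},$$ where $S_\lambda$ is the Schur module of $GL(n)$ for the partition $\lambda$, which is $\mathbb Z^n$-graded by weights under the diagonal matrices: it has a homogeneous basis indexed by the semistandard Young tableaux of shape $\lambda$ with $n$ letters, the basis element of a tableau having degree $(a_1,\dots,a_n)$ with $a_k$ the number of entries equal to the $k$-th letter. For an integer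 $r\ge 1$ let $E({\bf e})^{(r)}$ be the complex obtained from $E({\bf e})$ by the substitution $x_k\mapsto x_k^r$; each summand $S(-{\bf a})$ becomes $S(-r{\bf a})$. **Statement.** Let $M$ be a finitely generated artinian $\mathbb Z^n$-graded $S$-module whose minimal $\mathbb Z^n$-graded free resolution becomes pure when taking total degrees, that is, there are integers $d_0<d_1<\dots<d_n$ such that the resolution has the form $$F_0\leftarrow F_1\leftarrow\cdots\leftarrow F_n,\qquad F_i=\bigoplus_{|{\bf a}|=d_i}S(-{\bf a})^{\pi_{i,{\bf a}}}.$$ Let $\pi=\{\pi_{i,{\bf a}}\}$ be its $\mathbb Z^n$-graded Betti diagram, let $e_i=d_i-d_{i-1}$ for $i=1,\dots,n$, let $r=\gcd(e_1,\dots,e_n)$, and write ${\bf e}=r\cdot{\bf e}'$. Let $\beta=\{\beta_{i,{\bf a}}\}$ be the $\mathbb Z^n$-graded Betti diagram of $E({\bf e}')^{(r)}$ (which is $E({\bf e})$ itself if $r=1$). For a diagram $\gamma=\{\gamma_{i,{\bf a}}\}$ let $\overline\gamma$ be the associated $\mathbb Z$-graded diagram, $\overline\gamma_{i,j}=\sum_{|{\bf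 a}|=j}\gamma_{i,{\bf a}}$. Then $\overline\pi$ is an integer multiple of a twist of $\overline\beta$: there are integers $m$ and $c$ such that $$\overline\pi_{i,j}=m\cdot\overline\beta_{i,j-c}\qquad\text{for all } i=0,\dots,n \text{ and all } j\in\mathbb Z.$$ -/

import Mathlib

open scoped BigOperators

noncomputable section

namespace MultigradedBetti

/-! ### Multigraded free modules and minimal free resolutions -/

/-- The degree-`a` part `S_a` of the polynomial ring `S = 𝕜[x_1, …, x_n]` in its `ℤ^n`-grading, in
which `x_k` has degree the `k`-th unit vector. -/
abbrev polyGrading (𝕜 : Type*) [Field 𝕜] (n : ℕ) :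
    (Fin n → ℤ) → Submodule 𝕜 (MvPolynomial (Fin n) 𝕜) :=
  MvPolynomial.weightedHomogeneousSubmodule 𝕜 (fun k : Fin n => (Pi.single k 1 : Fin n → ℤ))

/-- The combinatorial data of a finitely generated `ℤ^n`-graded free module `⨁_g S(-deg g)`:
a finite set of free homogeneous generators together with their multidegrees. -/
structure FreeData (n : ℕ) where
  gens : Type
  [fintypeGens : Fintype gens]
  deg : gens → (Fin n → ℤ)

attribute [instance] FreeData.fintypeGens

/-- The underlying free module `⨁_g S` over `S = 𝕜[x_1, …, x_n]`. -/
abbrev FreeData.Carrier {n : ℕ} (F : FreeData n) (𝕜 : Type*) [Field 𝕜] : Type _ :=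
  F.gens →₀ MvPolynomial (Fin n) 𝕜

/-- The free generator belonging to `g`. -/
abbrev FreeData.gen {n : ℕ} (F : FreeData n) (𝕜 : Type*) [Field 𝕜] (g : F.gens) :
    F.Carrier 𝕜 :=
  Finsupp.single g 1

/-- The multigraded Betti numbers of a graded free module: the coefficient at `a ∈ ℤ^n` is the
number of generators of multidegree `a`, that is, the multiplicity of the summand `S(-a)`. -/
def FreeData.betti {n : ℕ} (F : FreeData n) : (Fin n → ℤ) →₀ ℕ :=
  ∑ g : F.gens, Finsupp.single (F.deg g) 1

/-- The term `F^{(r)} = F ⊗_S S^{(r)}`, where `S^{(r)}` is `S` regarded as an `S`-module through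
`x_k ↦ x_k ^ r`: the summand `S(-a)` becomes `S(-r a)`. -/
def FreeData.frobenius {n : ℕ} (r : ℕ) (F : FreeData n) : FreeData n where
  gens := F.gens
  deg g := fun k => (r : ℤ) * F.deg g k

/-- A minimal `ℤ^n`-graded free resolution `⋯ → F_1 → F_0 → M → 0`, with all terms finitely
generated, of a module `M` with grading `𝓜` over `S = 𝕜[x_1, …, x_n]`. -/
structure MinimalFreeResolution (𝕜 : Type*) [Field 𝕜] (n : ℕ) {M : Type*} [AddCommGroup M]
    [Module 𝕜 M] [Module (MvPolynomial (Fin n) 𝕜) M] (𝓜 : (Fin n → ℤ) → Submodule 𝕜 M) where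
  term : ℕ → FreeData n
  d : ∀ i : ℕ, (term (i + 1)).Carrier 𝕜 →ₗ[MvPolynomial (Fin n) 𝕜] (term i).Carrier 𝕜
  aug : (term 0).Carrier 𝕜 →ₗ[MvPolynomial (Fin n) 𝕜] M
  /-- the differentials are homogeneous of degree `0`: the entry of the matrix from the summand
  `S(-deg g)` to the summand `S(-deg h)` lies in `S_{deg g - deg h}` -/
  d_homogeneous : ∀ (i : ℕ) (g : (term (i + 1)).gens) (h : (term i).gens),
    d i ((term (i + 1)).gen 𝕜 g) h ∈ polyGrading 𝕜 n ((term (i + 1)).deg g - (term i).deg h)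
  /-- the augmentation is homogeneous of degree `0` -/
  aug_homogeneous : ∀ g : (term 0).gens, aug ((term 0).gen 𝕜 g) ∈ 𝓜 ((term 0).deg g)
  aug_surjective : Function.Surjective aug
  exact_zero : Function.Exact (d 0) aug
  exact_succ : ∀ i : ℕ, Function.Exact (d (i + 1)) (d i)
  /-- minimality: the image of each differential lies in `(x_1, …, x_n) F_i` -/
  minimal : ∀ (i : ℕ) (v : (term (i + 1)).Carrier 𝕜) (h : (term i).gens),
    MvPolynomial.constantCoeff (d i v h) = 0

/-- The resolution becomes pure of type `d_0, …, d_n` after taking total degrees: it has the form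
`F_0 ← F_1 ← ⋯ ← F_n`, and all generators of `F_i` have total degree `d_i`. -/
def MinimalFreeResolution.IsPure {𝕜 : Type*} [Field 𝕜] {n : ℕ} {M : Type*} [AddCommGroup M]
    [Module 𝕜 M] [Module (MvPolynomial (Fin n) 𝕜) M] {𝓜 : (Fin n → ℤ) → Submodule 𝕜 M}
    (F : MinimalFreeResolution 𝕜 n 𝓜) (d : Fin (n + 1) → ℤ) : Prop :=
  (∀ (i : Fin (n + 1)) (g : (F.term i).gens), ∑ k, (F.term i).deg g k = d i) ∧
    ∀ i : ℕ, n < i → IsEmpty (F.term i).gens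

/-! ### Betti diagrams -/

/-- Diagrams `{β_{i,a}}` with `i = 0, …, n` and `a ∈ ℤ^n`. -/
abbrev MultiDiagram (n : ℕ) : Type := Fin (n + 1) → ((Fin n → ℤ) →₀ ℕ)

/-- The multigraded Betti diagram of (the module resolved by) a minimal resolution. -/
def MinimalFreeResolution.bettiDiagram {𝕜 : Type*} [Field 𝕜] {n : ℕ} {M : Type*} [AddCommGroup M]
    [Module 𝕜 M] [Module (MvPolynomial (Fin n) 𝕜) M] {𝓜 : (Fin n → ℤ) → Submodule 𝕜 M}
    (F : MinimalFreeResolution 𝕜 n 𝓜) : MultiDiagram n :=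
  fun i => (F.term i).betti

/-- The `ℤ`-graded diagram associated to a `ℤ^n`-graded one by taking total degrees: the entry at
`(i, c)` is the sum of the `β_{i,a}` over all `a` with `|a| = c`. -/
def MultiDiagram.total {n : ℕ} (β : MultiDiagram n) : Fin (n + 1) → (ℤ →₀ ℕ) :=
  fun i => (β i).mapDomain fun a => ∑ k, a k

/-! ### The equivariant resolution -/

/-- The partitions `α(e, i) = (λ_1 + e_1, …, λ_i + e_i, λ_{i+1}, …, λ_n)`, where
`λ_j = ∑_{l > j} (e_l - 1)`. -/
def alpha {n : ℕ} (e : Fin n → ℕ) (i : Fin (n + 1)) (j : Fin n) : ℕ :=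
  (∑ l ∈ Finset.Ioi j, (e l - 1)) + if (j : ℕ) < (i : ℕ) then e j else 0

theorem alpha_antitone {n : ℕ} (e : Fin n → ℕ) (he : ∀ j, 0 < e j) (i : Fin (n + 1)) :
    Antitone (alpha e i) := by
  intro j j' hjj'
  rcases hjj'.eq_or_lt with rfl | hlt
  · exact le_rfl
  have hsub : insert j' (Finset.Ioi j') ⊆ Finset.Ioi j := by
    intro l hl
    rcases Finset.mem_insert.1 hl with rfl | hl
    · exact Finset.mem_Ioi.2 hlt
    · exact Finset.mem_Ioi.2 (hlt.trans (Finset.mem_Ioi.1 hl))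
  have hsum := Finset.sum_le_sum_of_subset (f := fun l => e l - 1) hsub
  rw [Finset.sum_insert (by simp)] at hsum
  have h1 := he j
  have h2 := he j'
  have h3 : (j : ℕ) < (j' : ℕ) := hlt
  unfold alpha
  split_ifs <;> omega

/-- The Young diagram of the partition `α(e, i)`. -/
def alphaDiagram {n : ℕ} (e : Fin n → ℕ) (he : ∀ j, 0 < e j) (i : Fin (n + 1)) : YoungDiagram :=
  YoungDiagram.ofRowLens (List.ofFn (alpha e i)) (alpha_antitone e he i).sortedGE_ofFn

/-- Semistandard Young tableaux of shape `μ` with entries in an alphabet of `n` letters (here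
`0, …, n - 1`). They index the standard basis of the Schur module `S_μ` of `GL(n)`. -/
def Tableau (n : ℕ) (μ : YoungDiagram) : Type :=
  {T : SemistandardYoungTableau μ // ∀ i j : ℕ, (i, j) ∈ μ → T i j < n}

instance Tableau.finite (n : ℕ) (μ : YoungDiagram) : Finite (Tableau n μ) := by
  let f : Tableau n μ → (μ.cells → Fin n) := fun T c =>
    ⟨T.1 c.1.1 c.1.2, T.2 c.1.1 c.1.2 c.2⟩
  refine Finite.of_injective f fun T T' h => Subtype.ext (SemistandardYoungTableau.ext ?_)
  intro i j
  by_cases hij : (i, j) ∈ μ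
  · exact congrArg Fin.val (congrFun h ⟨(i, j), hij⟩)
  · rw [T.1.zeros hij, T'.1.zeros hij]

/-- The content of a tableau, which is the weight of the corresponding basis element of the Schur
module under the diagonal matrices: its `k`-th coordinate is the number of entries equal to `k`. -/
def Tableau.content {n : ℕ} {μ : YoungDiagram} (T : Tableau n μ) : Fin n → ℤ :=
  fun k => (((μ.cells.filter fun c => T.1 c.1 c.2 = (k : ℕ)).card : ℕ) : ℤ)

/-- The `ℤ^n`-graded free module `S ⊗ S_μ`, where `S_μ` is the Schur module of `GL(n)` with its
decomposition into weight spaces. -/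
def schurFree (n : ℕ) (μ : YoungDiagram) : FreeData n where
  gens := Tableau n μ
  fintypeGens := Fintype.ofFinite _
  deg := Tableau.content

/-- The terms `S ⊗ S_{α(e,0)} ← S ⊗ S_{α(e,1)} ← ⋯ ← S ⊗ S_{α(e,n)}` of the equivariant
resolution `E(e)`. -/
def equivariantTerm {n : ℕ} (e : Fin n → ℕ) (he : ∀ j, 0 < e j) (i : Fin (n + 1)) : FreeData n :=
  schurFree n (alphaDiagram e he i)

/-- The multigraded Betti diagram of `E(e)^{(r)}`, the complex obtained from the equivariant
resolution `E(e)` by substituting `x_k ↦ x_k ^ r`. -/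
def equivariantBettiDiagram {n : ℕ} (r : ℕ) (e : Fin n → ℕ) (he : ∀ j, 0 < e j) :
    MultiDiagram n :=
  fun i => ((equivariantTerm e he i).frobenius r).betti

end MultigradedBetti

end

/-!
# Pure multigraded resolutions and the equivariant resolution

Let `P_i` be the generating function of the multidegrees of the generators of `F_i`. The Hilbert
series of an artinian module is a Laurent polynomial, so `∑ (-1)^i P_i` vanishes as soon as one of
the variables is set to `1` (`sum_update_deg_eq_zero`; the proof counts dimensions in a single
multidegree and inverts the resulting summatory functions). Since `P_i` is homogeneous of degree
`d_i`, the variable can be restored: `∑ (-1)^i x_k ^ (d_n - d_i) P_i = 0` for each `k`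
(`sum_pow_codegree_mul_genPoly`). By Cramer's rule the `P_i` are therefore proportional to the
maximal minors of the generalized Vandermonde matrix `(x_k ^ (d_n - d_i))`.

By the bialternant formula (`diffProd_mul_schurValue`) the `i`-th minor is the product of all
`x_k ^ r - x_l ^ r` and the Schur polynomial `s_i` of `α(e', i)` at the `r`-th powers of the
variables. The value of `s_i` at `(1, …, 1)` is the number of semistandard tableaux of shape
`α(e', i)` (`schurValue_one`, by the branching rule `tableauCount_succ`), that is, the rank of the
`i`-th term of the equivariant resolution.

The `s_i` have no common prime factor (`exists_not_dvd_of_prime`), so the proportionality factor is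
a polynomial `R` with integer coefficients, `P_i = R s_i`, and the integer looked for is `R(1, …,
1)`. For the coprimality let `f` be a prime polynomial that divides all the `s_i`. It is not
constant, since the minors have a coefficient `1`. As it divides all minors, the rows `w_k = (x_k ^
(d_n - d_i))_i` satisfy a linear relation modulo `f`. If `f` involves three variables, a derivation
that kills `f` gives a second relation, with two rows of derivatives, and one of the variables of
`f` can be eliminated from both. This contradicts the nonvanishing of confluent generalized
Vandermonde determinants (`dvd_of_relation`), which follows from Descartes' rule of signs at
positive points. Neither can `f` involve one variable only, as all rows end in `1`. If `f` involves
the two variables `x_p` and `x_q` only, then `f` divides `x_p ^ r - x_q ^ r`, and the same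
nonvanishing shows that it no longer divides all minors after division by this difference.
-/

namespace MultigradedBetti

/-! ### Branching of semistandard tableaux -/

/-- The Young diagram with the row lengths `l 0 ≥ l 1 ≥ ⋯ ≥ l (n - 1)`. -/
noncomputable def rowShape {n : ℕ} (l : Fin n → ℕ) (hl : Antitone l) : YoungDiagram :=
  YoungDiagram.ofRowLens (List.ofFn l) hl.sortedGE_ofFn

theorem mem_rowShape {n : ℕ} {l : Fin n → ℕ} {hl : Antitone l} {i j : ℕ} :
    (i, j) ∈ rowShape l hl ↔ ∃ h : i < n, j < l ⟨i, h⟩ := by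
  simp [rowShape, YoungDiagram.mem_ofRowLens]

open Classical in
/-- The number of semistandard tableaux with entries `< n` and row lengths `l`; it is `0` if `l`
is not a partition. -/
noncomputable def tableauCount {n : ℕ} (l : Fin n → ℕ) : ℕ :=
  if hl : Antitone l then Nat.card (Tableau n (rowShape l hl)) else 0

theorem tableauCount_eq {n : ℕ} {l : Fin n → ℕ} (hl : Antitone l) :
    tableauCount l = Nat.card (Tableau n (rowShape l hl)) := dif_pos hl

theorem lt_card_filter_range_iff {p : ℕ → Prop} [DecidablePred p] {N c : ℕ} (hc : c < N)
    (hp : ∀ a b, a ≤ b → b < N → p b → p a) :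
    c < ((Finset.range N).filter p).card ↔ p c := by
  constructor
  · intro h
    by_contra hpc
    have hsub : (Finset.range N).filter p ⊆ Finset.range c := by
      intro a ha
      rw [Finset.mem_filter, Finset.mem_range] at ha
      rw [Finset.mem_range]
      by_contra hac
      exact hpc (hp c a (by omega) ha.1 ha.2)
    have := Finset.card_le_card hsub
    rw [Finset.card_range] at this
    omega
  · intro h
    have hsub : Finset.range (c + 1) ⊆ (Finset.range N).filter p := by
      intro a ha
      rw [Finset.mem_range] at ha
      rw [Finset.mem_filter, Finset.mem_range]
      exact ⟨by omega, hp a c (by omega) hc h⟩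
    have := Finset.card_le_card hsub
    rw [Finset.card_range] at this
    omega

/-- The lengths of the rows of the subtableau of entries different from the largest letter `n`. -/
def cutRows {n : ℕ} (l : Fin (n + 1) → ℕ) {μ : YoungDiagram} (T : Tableau (n + 1) μ) :
    Fin n → ℕ :=
  fun j => ((Finset.range (l j.castSucc)).filter fun c => T.1 j c < n).card

theorem lt_cutRows_iff {n : ℕ} {l : Fin (n + 1) → ℕ} {hl : Antitone l}
    (T : Tableau (n + 1) (rowShape l hl)) (j : Fin n) {c : ℕ} (hc : c < l j.castSucc) :
    c < cutRows l T j ↔ T.1 j c < n := by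
  refine lt_card_filter_range_iff (p := fun c => T.1 j c < n) hc fun a b hab hb h => ?_
  exact (T.1.row_weak_of_le hab (mem_rowShape.2 ⟨by omega, hb⟩)).trans_lt h

/-- The row lengths of the diagrams with at most `n` rows that interlace `l`. -/
def interlacing {n : ℕ} (l : Fin (n + 1) → ℕ) : Finset (Fin n → ℕ) :=
  Fintype.piFinset fun j => Finset.Icc (l j.succ) (l j.castSucc)

theorem mem_interlacing {n : ℕ} {l : Fin (n + 1) → ℕ} {m : Fin n → ℕ} :
    m ∈ interlacing l ↔ ∀ j, l j.succ ≤ m j ∧ m j ≤ l j.castSucc := by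
  simp [interlacing, Fintype.mem_piFinset]

theorem antitone_of_mem_interlacing {n : ℕ} {l : Fin (n + 1) → ℕ} {m : Fin n → ℕ}
    (hl : Antitone l) (hm : m ∈ interlacing l) : Antitone m := by
  intro i j hij
  rw [mem_interlacing] at hm
  rcases hij.eq_or_lt with rfl | h
  · exact le_rfl
  · refine (hm j).2.trans (le_trans (hl ?_) (hm i).1)
    rw [Fin.le_def]
    simpa using h

theorem cutRows_mem_interlacing {n : ℕ} {l : Fin (n + 1) → ℕ} {hl : Antitone l}
    (T : Tableau (n + 1) (rowShape l hl)) : cutRows l T ∈ interlacing l := by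
  refine mem_interlacing.2 fun j => ⟨?_, ?_⟩
  · by_contra! h
    have hle : l j.succ ≤ l j.castSucc := hl (by simp [Fin.le_def])
    have hmem : ((j : ℕ) + 1, cutRows l T j) ∈ rowShape l hl :=
      mem_rowShape.2 ⟨by omega, by simpa [Fin.succ] using h⟩
    have h1 := T.1.col_strict (Nat.lt_add_one (j : ℕ)) hmem
    have h2 := T.2 _ _ hmem
    have := (lt_cutRows_iff T j (h.trans_le hle)).2 (by omega)
    omega
  · exact (Finset.card_filter_le _ _).trans (by simp)

/-- A tableau is determined by the subtableau of entries different from the largest letter, whose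
shape may be any interlacing partition. -/
noncomputable def cutEquiv {n : ℕ} {l : Fin (n + 1) → ℕ} (hl : Antitone l) {m : Fin n → ℕ}
    (hm : m ∈ interlacing l) (hma : Antitone m) :
    {T : Tableau (n + 1) (rowShape l hl) // cutRows l T = m} ≃ Tableau n (rowShape m hma) := by
  have hsub : ∀ {i j : ℕ}, (i, j) ∈ rowShape m hma → (i, j) ∈ rowShape l hl := by
    intro i j h
    obtain ⟨hi, hj⟩ := mem_rowShape.1 h
    exact mem_rowShape.2 ⟨by omega, hj.trans_le (mem_interlacing.1 hm ⟨i, hi⟩).2⟩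
  have hcol : ∀ {i i' j : ℕ}, i < i' → (i', j) ∈ rowShape l hl → (i, j) ∈ rowShape m hma := by
    intro i i' j hii h
    obtain ⟨hi', hj⟩ := mem_rowShape.1 h
    refine mem_rowShape.2 ⟨by omega, ?_⟩
    refine lt_of_lt_of_le hj (le_trans (hl ?_) (mem_interlacing.1 hm ⟨i, by omega⟩).1)
    simp only [Fin.le_def, Fin.succ]
    omega
  have hsmall : ∀ T : Tableau (n + 1) (rowShape l hl), cutRows l T = m → ∀ {i j : ℕ},
      (i, j) ∈ rowShape l hl → (T.1 i j < n ↔ (i, j) ∈ rowShape m hma) := by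
    intro T hT i j h
    obtain ⟨hi, hj⟩ := mem_rowShape.1 h
    by_cases hin : i < n
    · rw [← lt_cutRows_iff T ⟨i, hin⟩ hj, hT, mem_rowShape]
      simp [hin]
    · have hno : (i, j) ∉ rowShape m hma := fun h' => hin (mem_rowShape.1 h').1
      refine iff_of_false ?_ hno
      have key : ∀ k, k ≤ i → k ≤ T.1 k j := by
        intro k
        induction k with
        | zero => simp
        | succ k ih =>
          intro hk
          have := T.1.col_strict (Nat.lt_add_one k)
            ((rowShape l hl).up_left_mem hk le_rfl h)
          have := ih (by omega)
          omega
      have := key i le_rfl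
      omega
  classical
  refine
    { toFun := fun T => ⟨⟨fun i j => if (i, j) ∈ rowShape m hma then T.1.1 i j else 0, ?_, ?_, ?_⟩,
        ?_⟩
      invFun := fun T => ⟨⟨⟨fun i j => if (i, j) ∈ rowShape l hl then
        (if (i, j) ∈ rowShape m hma then T.1 i j else n) else 0, ?_, ?_, ?_⟩, ?_⟩, ?_⟩
      left_inv := ?_
      right_inv := ?_ }
  · intro i j1 j2 hj h
    rw [if_pos h, if_pos ((rowShape m hma).up_left_mem le_rfl hj.le h)]
    exact T.1.1.row_weak hj (hsub h)
  · intro i1 i2 j hi h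
    rw [if_pos h, if_pos ((rowShape m hma).up_left_mem hi.le le_rfl h)]
    exact T.1.1.col_strict hi (hsub h)
  · intro i j h
    rw [if_neg h]
  · intro i j h
    change (if (i, j) ∈ rowShape m hma then T.1.1 i j else 0) < n
    rw [if_pos h]
    exact (hsmall T.1 T.2 (hsub h)).2 h
  · intro i j1 j2 hj h
    rw [if_pos h, if_pos ((rowShape l hl).up_left_mem le_rfl hj.le h)]
    by_cases h2 : (i, j2) ∈ rowShape m hma
    · rw [if_pos h2, if_pos ((rowShape m hma).up_left_mem le_rfl hj.le h2)]
      exact T.1.row_weak hj h2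
    · rw [if_neg h2]
      split_ifs with h1
      · exact (T.2 _ _ h1).le
      · exact le_rfl
  · intro i1 i2 j hi h
    rw [if_pos h, if_pos ((rowShape l hl).up_left_mem hi.le le_rfl h), if_pos (hcol hi h)]
    split_ifs with h2
    · exact T.1.col_strict hi h2
    · exact T.2 _ _ (hcol hi h)
  · intro i j h
    rw [if_neg h]
  · intro i j h
    change (if (i, j) ∈ rowShape l hl then
      (if (i, j) ∈ rowShape m hma then T.1 i j else n) else 0) < n + 1
    rw [if_pos h]
    split_ifs with h2
    · exact (T.2 _ _ h2).trans (Nat.lt_succ_self n)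
    · exact Nat.lt_succ_self n
  · funext k
    have hle := (mem_interlacing.1 hm k).2
    have : ((Finset.range (l k.castSucc)).filter fun c =>
        (if ((k : ℕ), c) ∈ rowShape l hl then
          (if ((k : ℕ), c) ∈ rowShape m hma then T.1 k c else n) else 0) < n) =
        Finset.range (m k) := by
      ext c
      rw [Finset.mem_filter, Finset.mem_range, Finset.mem_range]
      constructor
      · rintro ⟨hc, h⟩
        rw [if_pos (mem_rowShape.2 ⟨by omega, hc⟩)] at h
        by_contra hcm
        rw [if_neg (fun h' => hcm (mem_rowShape.1 h').2)] at h
        omega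
      · intro hc
        have hmem : ((k : ℕ), c) ∈ rowShape m hma := mem_rowShape.2 ⟨k.2, hc⟩
        refine ⟨hc.trans_le hle, ?_⟩
        rw [if_pos (hsub hmem), if_pos hmem]
        exact T.2 _ _ hmem
    have h2 := congrArg Finset.card this
    rw [Finset.card_range] at h2
    exact h2
  · rintro ⟨T, hT⟩
    refine Subtype.ext (Subtype.ext (SemistandardYoungTableau.ext fun i j => ?_))
    change (if (i, j) ∈ rowShape l hl then (if (i, j) ∈ rowShape m hma then
      (if (i, j) ∈ rowShape m hma then T.1 i j else 0) else n) else 0) = T.1 i j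
    split_ifs with h1 h2
    · rfl
    · have h3 := T.2 _ _ h1
      have h4 := (hsmall T hT h1).not.2 h2
      omega
    · exact (T.1.zeros h1).symm
  · intro T
    refine Subtype.ext (SemistandardYoungTableau.ext fun i j => ?_)
    change (if (i, j) ∈ rowShape m hma then (if (i, j) ∈ rowShape l hl then
      (if (i, j) ∈ rowShape m hma then T.1 i j else n) else 0) else 0) = T.1 i j
    split_ifs with h1 h2
    · rfl
    · exact absurd (hsub h1) h2
    · exact (T.1.zeros h1).symm

/-- The branching rule for semistandard tableaux. -/
theorem tableauCount_succ {n : ℕ} {l : Fin (n + 1) → ℕ} (hl : Antitone l) :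
    tableauCount l = ∑ m ∈ interlacing l, tableauCount m := by
  classical
  have := Fintype.ofFinite (Tableau (n + 1) (rowShape l hl))
  rw [tableauCount_eq hl, Nat.card_eq_fintype_card, ← Finset.card_univ,
    Finset.card_eq_sum_card_fiberwise (f := cutRows l) (t := interlacing l)
      (fun T _ => cutRows_mem_interlacing T)]
  refine Finset.sum_congr rfl fun m hm => ?_
  have hma := antitone_of_mem_interlacing hl hm
  rw [tableauCount_eq hma, ← Nat.card_congr (cutEquiv hl hm hma), Nat.card_eq_fintype_card,
    Fintype.card_subtype]

theorem tableauCount_zero (l : Fin 0 → ℕ) : tableauCount l = 1 := by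
  have hl : Antitone l := fun i => i.elim0
  rw [tableauCount_eq hl, Nat.card_eq_one_iff_unique]
  have hmem : ∀ i j, (i, j) ∉ rowShape l hl := fun i j h => by
    obtain ⟨hi, -⟩ := mem_rowShape.1 h
    omega
  refine ⟨⟨fun T T' => Subtype.ext (SemistandardYoungTableau.ext fun i j => ?_)⟩, ⟨⟨⟨fun _ _ => 0,
    fun _ _ => le_rfl, fun _ h => absurd h (hmem _ _), fun _ => rfl⟩,
    fun _ _ h => absurd h (hmem _ _)⟩⟩⟩
  rw [T.1.zeros (hmem _ _), T'.1.zeros (hmem _ _)]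

/-! ### Schur polynomials and the bialternant formula -/

/-- The exponents `m` of the alternants with one variable less that interlace the strictly
decreasing exponents `l`. -/
def strictInterlacing {n : ℕ} (l : Fin (n + 1) → ℕ) : Finset (Fin n → ℕ) :=
  Fintype.piFinset fun j => Finset.Ico (l j.succ) (l j.castSucc)

/-- The value at `x` of the Schur polynomial of the partition `l 0 - (n - 1), …, l (n - 1) - 0`,
defined through the branching rule with respect to the variable `x 0`. -/
def schurValue {R : Type*} [CommRing R] : (n : ℕ) → (Fin n → R) → (Fin n → ℕ) → R
  | 0, _, _ => 1
  | n + 1, x, l => ∑ m ∈ strictInterlacing l, schurValue n (fun k => x k.succ) m *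
      (x 0 ^ l (Fin.last n) * ∏ j : Fin n, x 0 ^ (l j.castSucc - 1 - m j))

theorem map_schurValue {R S : Type*} [CommRing R] [CommRing S] (φ : R →+* S) :
    ∀ (n : ℕ) (x : Fin n → R) (l : Fin n → ℕ),
      φ (schurValue n x l) = schurValue n (fun k => φ (x k)) l
  | 0, _, _ => map_one φ
  | n + 1, x, l => by
    simp only [schurValue, map_sum, map_mul, map_prod, map_pow, map_schurValue φ n]

/-- At `(1, …, 1)` both sides satisfy the same branching rule, with the exponents shifted by the
staircase `n - 1, …, 1, 0`. -/
theorem schurValue_one : ∀ (n : ℕ) (l : Fin n → ℕ), Antitone l →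
    schurValue n (fun _ => (1 : ℤ)) (fun j => l j + (n - 1 - j)) = tableauCount l
  | 0, l, _ => by simp [schurValue, tableauCount_zero]
  | n + 1, l, hl => by
    simp only [schurValue, one_pow, Finset.prod_const_one, mul_one]
    rw [tableauCount_succ hl, Nat.cast_sum]
    symm
    refine Finset.sum_bij (fun m _ j => m j + (n - 1 - j)) ?_ ?_ ?_ ?_
    · intro m hm
      rw [mem_interlacing] at hm
      simp only [strictInterlacing, Fintype.mem_piFinset, Finset.mem_Ico, Fin.val_succ,
        Fin.val_castSucc]
      intro j
      have := hm j
      omega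
    · intro m _ m' _ h
      funext j
      have := congrFun h j
      simpa using this
    · intro m hm
      simp only [strictInterlacing, Fintype.mem_piFinset, Finset.mem_Ico, Fin.val_succ,
        Fin.val_castSucc] at hm
      refine ⟨fun j => m j - (n - 1 - j), mem_interlacing.2 fun j => ?_, ?_⟩
      · have := hm j
        omega
      · funext j
        have := hm j
        change m j - (n - 1 - j) + (n - 1 - j) = m j
        omega
    · intro m hm
      exact (schurValue_one n m (antitone_of_mem_interlacing hl hm)).symm

open Matrix in
theorem det_eq_of_forall_col_eq_smul_add_succ {R : Type*} [CommRing R] {n : ℕ}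
    {A B : Matrix (Fin (n + 1)) (Fin (n + 1)) R} (c : Fin n → R)
    (A_last : ∀ i, A i (Fin.last n) = B i (Fin.last n))
    (A_castSucc : ∀ (i) (j : Fin n), A i j.castSucc = B i j.castSucc + c j * A i j.succ) :
    det A = det B := by
  have h : det (A.submatrix id Fin.revPerm) = det (B.submatrix id Fin.revPerm) := by
    refine det_eq_of_forall_col_eq_smul_add_pred (fun j => c j.rev) ?_ ?_
    · intro i
      simpa using A_last i
    · intro i j
      have := A_castSucc i j.rev
      simpa [Fin.rev_succ, Fin.rev_castSucc] using this
  rw [det_permute', det_permute'] at h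
  rcases Int.units_eq_one_or (Equiv.Perm.sign (Fin.revPerm : Equiv.Perm (Fin (n + 1)))) with hs | hs
    <;> simpa [hs] using h

open Matrix in
theorem det_sum_columns {R ι : Type*} [CommRing R] [DecidableEq ι] {n : ℕ} (S : Fin n → Finset ι)
    (a : Fin n → ι → R) (b : Fin n → ι → Fin n → R) :
    det (of fun k j : Fin n => ∑ m ∈ S j, a j m * b j m k) =
      ∑ m ∈ Fintype.piFinset S, (∏ j, a j (m j)) * det (of fun k j => b j (m j) k) := by
  rw [← det_transpose]
  have h1 : (of fun k j : Fin n => ∑ m ∈ S j, a j m * b j m k)ᵀ =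
      fun j => ∑ m ∈ S j, a j m • b j m := by
    ext j k
    simp [Finset.sum_apply]
  rw [h1]
  have h2 := (detRowAlternating (R := R) (n := Fin n)).toMultilinearMap.map_sum_finset
    (fun j m => a j m • b j m) S
  refine h2.trans (Finset.sum_congr rfl fun m _ => ?_)
  rw [← det_transpose (of fun k j => b j (m j) k)]
  have h3 := (detRowAlternating (R := R) (n := Fin n)).toMultilinearMap.map_smul_univ
    (fun j => a j (m j)) (fun j => b j (m j))
  exact h3

/-- The geometric sum that a column operation leaves behind in an alternant. -/
theorem pow_sub_pow_eq_mul_sum_Ico {R : Type*} [CommRing R] (x y : R) {p q : ℕ} (h : q ≤ p) :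
    y ^ p - x ^ (p - q) * y ^ q =
      (y - x) * ∑ m ∈ Finset.Ico q p, x ^ (p - 1 - m) * y ^ m := by
  obtain ⟨t, rfl⟩ := Nat.exists_eq_add_of_le h
  rw [Finset.sum_Ico_eq_sum_range, Nat.add_sub_cancel_left]
  have h1 : ∑ m ∈ Finset.range t, x ^ (q + t - 1 - (q + m)) * y ^ (q + m) =
      y ^ q * ∑ m ∈ Finset.range t, y ^ m * x ^ (t - 1 - m) := by
    rw [Finset.mul_sum]
    refine Finset.sum_congr rfl fun m hm => ?_
    rw [show q + t - 1 - (q + m) = t - 1 - m by omega, pow_add]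
    ring
  rw [h1, mul_left_comm, mul_comm (y - x), geom_sum₂_mul, pow_add]
  ring

/-- The product `∏_{i < j} (x_i - x_j)`. -/
def diffProd {R : Type*} [CommRing R] {n : ℕ} (x : Fin n → R) : R :=
  ∏ i, ∏ j ∈ Finset.Ioi i, (x i - x j)

theorem diffProd_succ {R : Type*} [CommRing R] {n : ℕ} (x : Fin (n + 1) → R) :
    diffProd x = (∏ k : Fin n, (x 0 - x k.succ)) * diffProd fun k : Fin n => x k.succ := by
  simp only [diffProd, Fin.prod_univ_succ, Fin.prod_Ioi_zero, Fin.prod_Ioi_succ]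

open Matrix in
/-- The bialternant formula: an alternant is the product of all differences of the variables and
a Schur polynomial. -/
theorem diffProd_mul_schurValue {R : Type*} [CommRing R] :
    ∀ (n : ℕ) (x : Fin n → R) (l : Fin n → ℕ), StrictAnti l →
      diffProd x * schurValue n x l = det (of fun k j => x k ^ l j)
  | 0, x, l, _ => by simp [diffProd, schurValue]
  | n + 1, x, l, hl => by
    have hlt : ∀ j : Fin n, l j.succ < l j.castSucc := fun j => hl (by simp [Fin.lt_def])
    -- subtract from each column a multiple of the next one, to clear all but one entry of row `0`
    rw [det_eq_of_forall_col_eq_smul_add_succ (B := of fun k j => Fin.lastCases (x k ^ l (Fin.last n))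
        (fun j : Fin n => x k ^ l j.castSucc - x 0 ^ (l j.castSucc - l j.succ) * x k ^ l j.succ) j)
      (fun j : Fin n => x 0 ^ (l j.castSucc - l j.succ)) (by simp) (by simp),
      det_succ_row_zero, Fin.sum_univ_castSucc]
    have h0 : ∀ j : Fin n,
        x 0 ^ l j.castSucc - x 0 ^ (l j.castSucc - l j.succ) * x 0 ^ l j.succ = 0 := fun j => by
      rw [← pow_add, Nat.sub_add_cancel (hlt j).le, sub_self]
    simp only [of_apply, Fin.lastCases_castSucc, Fin.lastCases_last, h0, mul_zero, zero_mul,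
      Finset.sum_const_zero, zero_add, Fin.val_last]
    have h1 : ((of fun k j => Fin.lastCases (x k ^ l (Fin.last n))
        (fun j : Fin n => x k ^ l j.castSucc - x 0 ^ (l j.castSucc - l j.succ) * x k ^ l j.succ)
        j : Matrix (Fin (n + 1)) (Fin (n + 1)) R).submatrix Fin.succ (Fin.last n).succAbove) =
        of fun (k j : Fin n) => (x k.succ - x 0) *
          (of fun (k j : Fin n) => ∑ m ∈ Finset.Ico (l j.succ) (l j.castSucc),
            x 0 ^ (l j.castSucc - 1 - m) * x k.succ ^ m : Matrix (Fin n) (Fin n) R) k j := by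
      ext k j
      simp [pow_sub_pow_eq_mul_sum_Ico _ _ (hlt j).le]
    rw [h1, det_mul_column, det_sum_columns (fun j : Fin n => Finset.Ico (l j.succ) (l j.castSucc))
      (fun j m => x 0 ^ (l j.castSucc - 1 - m)) (fun _ m k => x (Fin.succ k) ^ m), diffProd_succ]
    have h2 : (-1 : R) ^ n * ∏ k : Fin n, (x k.succ - x 0) = ∏ k : Fin n, (x 0 - x k.succ) := by
      rw [← Fin.prod_const n (-1 : R), ← Finset.prod_mul_distrib]
      exact Finset.prod_congr rfl fun k _ => by ring
    rw [← h2, schurValue, Finset.mul_sum, Finset.mul_sum, Finset.mul_sum]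
    refine Finset.sum_congr rfl fun m hm => ?_
    have hma : StrictAnti m := by
      have hm' : ∀ j : Fin n, l j.succ ≤ m j ∧ m j < l j.castSucc := by
        simpa [strictInterlacing, Fintype.mem_piFinset] using hm
      intro i j hij
      refine lt_of_lt_of_le (hm' j).2 (le_trans (hl.antitone ?_) (hm' i).1)
      rw [Fin.le_def]
      simpa using hij
    rw [← diffProd_mul_schurValue n (fun k => x k.succ) m hma]
    ring

/-! ### Positive roots of sparse polynomials -/

open Polynomial in
theorem signVariations_lt_card_support {P : Polynomial ℚ} (hP : P ≠ 0) :
    signVariations P < P.support.card := by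
  generalize hc : P.support.card = c
  induction c generalizing P with
  | zero => exact absurd (card_support_eq_zero.1 hc) hP
  | succ c ih =>
    by_cases h0 : P.eraseLead = 0
    · have h1 : signVariations P = 0 := by
        rw [← eraseLead_add_monomial_natDegree_leadingCoeff P, h0, zero_add]
        exact signVariations_monomial _ _
      omega
    · have h1 := ih h0 (card_support_eraseLead' hc)
      have h2 := signVariations_le_eraseLead_succ (P := P)
      omega

open Polynomial in
/-- A polynomial cannot have as many positive roots, counted with multiplicity, as it has
monomials. -/
theorem card_add_card_lt_card_support {P : Polynomial ℚ} (hP : P ≠ 0) {T T' : Finset ℚ}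
    (hsub : T' ⊆ T) (hpos : ∀ y ∈ T, 0 < y) (hT : ∀ y ∈ T, P.IsRoot y)
    (hT' : ∀ y ∈ T', P.derivative.IsRoot y) : T.card + T'.card < P.support.card := by
  refine lt_of_le_of_lt ?_ (signVariations_lt_card_support hP)
  refine le_trans ?_ (roots_countP_pos_le_signVariations (P := P))
  have hle : T.val + T'.val ≤ P.roots := by
    rw [Multiset.le_iff_count]
    intro y
    rw [Multiset.count_add, count_roots]
    have h1 := Multiset.nodup_iff_count_le_one.1 T.nodup y
    have h2 := Multiset.nodup_iff_count_le_one.1 T'.nodup y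
    by_cases hy' : y ∈ T'
    · have := (one_lt_rootMultiplicity_iff_isRoot hP).2 ⟨hT y (hsub hy'), hT' y hy'⟩
      omega
    · have h3 : Multiset.count y T'.val = 0 := Multiset.count_eq_zero.2 hy'
      by_cases hy : y ∈ T
      · have := (rootMultiplicity_pos hP).2 (hT y hy)
        omega
      · have h4 : Multiset.count y T.val = 0 := Multiset.count_eq_zero.2 hy
        omega
  calc T.card + T'.card = Multiset.card (T.val + T'.val) := by simp
    _ = (T.val + T'.val).countP (0 < ·) := by
      symm
      rw [Multiset.countP_eq_card]
      intro y hy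
      rcases Multiset.mem_add.1 hy with h | h
      · exact hpos y h
      · exact hpos y (hsub h)
    _ ≤ _ := Multiset.countP_le_of_le _ hle

/-- A confluent version of the linear independence of the vectors `(y ^ c i)_i`, for positive `y`:
a vector of coefficients is zero if the polynomial `∑ b i Y ^ c i` vanishes on `T`, its derivative
vanishes on `T' ⊆ T`, and `T` and `T'` together have as many elements as there are monomials. -/
theorem eq_zero_of_sum_mul_pow_eq_zero {N : ℕ} {c : Fin N → ℕ} (hc : Function.Injective c)
    {T T' : Finset ℚ} (hsub : T' ⊆ T) (hpos : ∀ y ∈ T, 0 < y) (hcard : N ≤ T.card + T'.card)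
    {b : Fin N → ℚ} (hT : ∀ y ∈ T, ∑ i, y ^ c i * b i = 0)
    (hT' : ∀ y ∈ T', ∑ i, c i * y ^ c i * b i = 0) : b = 0 := by
  classical
  set P : Polynomial ℚ := ∑ i, Polynomial.monomial (c i) (b i) with hPdef
  have hcoeff : ∀ i, P.coeff (c i) = b i := by
    intro i
    rw [hPdef, Polynomial.finsetSum_coeff, Finset.sum_eq_single i]
    · simp
    · intro j _ hj
      rw [Polynomial.coeff_monomial, if_neg (hc.ne hj)]
    · simp
  have hsupp : P.support.card ≤ N := by
    have h1 : P.support ⊆ Finset.univ.image c := by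
      intro m hm
      rw [Polynomial.mem_support_iff, hPdef, Polynomial.finsetSum_coeff] at hm
      obtain ⟨i, -, hi⟩ := Finset.exists_ne_zero_of_sum_ne_zero hm
      rw [Polynomial.coeff_monomial] at hi
      exact Finset.mem_image.2 ⟨i, Finset.mem_univ _, by by_contra h; simp [h] at hi⟩
    calc _ ≤ _ := Finset.card_le_card h1
      _ ≤ Finset.univ.card := Finset.card_image_le
      _ = N := by simp
  by_contra hb
  have hP : P ≠ 0 := fun h => hb (funext fun i => by rw [← hcoeff i, h]; simp)
  have hlt := card_add_card_lt_card_support hP hsub hpos (fun y hy => ?_) (fun y hy => ?_)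
  · omega
  · rw [Polynomial.IsRoot, hPdef, Polynomial.eval_finsetSum, ← hT y hy]
    exact Finset.sum_congr rfl fun i _ => by rw [Polynomial.eval_monomial, mul_comm]
  · have hy0 : y ≠ 0 := (hpos y (hsub hy)).ne'
    rw [Polynomial.IsRoot]
    refine (mul_eq_zero.1 ?_).resolve_left hy0
    rw [hPdef, Polynomial.derivative_sum, Polynomial.eval_finsetSum, Finset.mul_sum, ← hT' y hy]
    refine Finset.sum_congr rfl fun i _ => ?_
    rw [Polynomial.derivative_monomial, Polynomial.eval_monomial]
    rcases Nat.eq_zero_or_pos (c i) with h | h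
    · simp [h]
    · calc y * (b i * (c i : ℚ) * y ^ (c i - 1)) = c i * y ^ (c i - 1 + 1) * b i := by ring
        _ = _ := by rw [Nat.sub_add_cancel h]

/-! ### Relations between generalized Vandermonde rows modulo a prime polynomial -/

section Relations

open MvPolynomial Matrix

variable {n : ℕ}

theorem notMem_vars_of_dvd {f g : MvPolynomial (Fin n) ℤ} (h : f ∣ g) (hg : g ≠ 0) {q : Fin n}
    (hq : q ∉ g.vars) : q ∉ f.vars := by
  obtain ⟨t, rfl⟩ := h
  rw [mem_vars_iff_degreeOf_ne_zero, not_not] at hq ⊢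
  rw [degreeOf_mul_eq (left_ne_zero_of_mul hg) (right_ne_zero_of_mul hg)] at hq
  omega

theorem not_dvd_pderiv {f : MvPolynomial (Fin n) ℤ} {q : Fin n} (hq : q ∈ f.vars) :
    ¬ f ∣ pderiv q f := by
  classical
  have hd : f.degreeOf q ≠ 0 := mem_vars_iff_degreeOf_ne_zero.1 hq
  intro h
  by_cases h0 : pderiv q f = 0
  · obtain ⟨m, hm, hqm⟩ := (mem_vars_iff_mem_support q).1 hq
    have hqm' : m q ≠ 0 := Finsupp.mem_support_iff.1 hqm
    have h1 := coeff_pderiv (i := q) f (m - Finsupp.single q 1)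
    have h2 : m - Finsupp.single q 1 + Finsupp.single q 1 = m :=
      tsub_add_cancel_of_le (by
        rw [Finsupp.single_le_iff]
        omega)
    rw [h0, coeff_zero, h2] at h1
    rcases mul_eq_zero.1 h1.symm with h3 | h3
    · exact (mem_support_iff.1 hm) h3
    · norm_cast at h3
  · obtain ⟨t, ht⟩ := h
    have hlt : (pderiv q f).degreeOf q < f.degreeOf q := by
      rw [degreeOf_lt_iff (Nat.pos_of_ne_zero hd)]
      intro m hm
      rw [mem_support_iff, coeff_pderiv] at hm
      have h1 : m + Finsupp.single q 1 ∈ f.support := mem_support_iff.2 (left_ne_zero_of_mul hm)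
      have h2 := monomial_le_degreeOf q h1
      simp only [Finsupp.add_apply, Finsupp.single_eq_same] at h2
      omega
    rw [ht] at h0 hlt
    rw [degreeOf_mul_eq (left_ne_zero_of_mul h0) (right_ne_zero_of_mul h0)] at hlt
    omega

/-- If the determinant of a square matrix is not divisible by the prime `f`, then its rows are
linearly independent modulo `f`. -/
theorem dvd_of_dvd_vecMul {A ι : Type*} [CommRing A] [Fintype ι] [DecidableEq ι] {f : A}
    (hf : Prime f) {N : Matrix ι ι A} (hN : ¬ f ∣ N.det) {v : ι → A}
    (hv : ∀ i, f ∣ (v ᵥ* N) i) (k : ι) : f ∣ v k := by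
  have : IsDomain (A ⧸ Ideal.span {f}) :=
    (Ideal.Quotient.isDomain_iff_prime _).2 ((Ideal.span_singleton_prime hf.ne_zero).2 hf)
  have hdvd : ∀ a, Ideal.Quotient.mk (Ideal.span {f}) a = 0 ↔ f ∣ a := fun a => by
    rw [Ideal.Quotient.eq_zero_iff_mem, Ideal.mem_span_singleton]
  set φ := Ideal.Quotient.mk (Ideal.span {f})
  have h1 : (φ.mapMatrix N).det ≠ 0 := by
    rw [← RingHom.map_det, Ne, hdvd]
    exact hN
  rw [← hdvd]
  by_contra hk
  refine h1 (exists_vecMul_eq_zero_iff.1 ⟨fun k => φ (v k), fun h => hk (congrFun h k), ?_⟩)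
  funext i
  have := (hdvd _).2 (hv i)
  simpa [vecMul, dotProduct] using this

/-- Modulo a prime polynomial `f` that involves `X q`, the rows `(X k ^ c i)_i` for `k ≠ q`, the row
`(c i X p ^ c i)_i` of derivatives for one `p ≠ q`, and one further row `u` that is either constant
or a row of derivatives for another variable, are linearly independent. -/
theorem dvd_of_relation {f : MvPolynomial (Fin n) ℤ} (hf : Prime f) {q p : Fin n}
    (hq : q ∈ f.vars) (hp : p ≠ q) {c : Fin (n + 1) → ℕ} (hc : Function.Injective c)
    {u : Fin (n + 1) → MvPolynomial (Fin n) ℤ}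
    (hu : (u = fun i => C ((n : ℤ) + 1) ^ c i) ∨
      ∃ p', p' ≠ q ∧ p' ≠ p ∧ u = fun i => (c i : MvPolynomial (Fin n) ℤ) * X p' ^ c i)
    {b₀ : MvPolynomial (Fin n) ℤ} {b : Fin n → MvPolynomial (Fin n) ℤ}
    (hb : ∀ i, f ∣ b₀ * u i + (b q * ((c i : MvPolynomial (Fin n) ℤ) * X p ^ c i) +
      ∑ k ∈ Finset.univ.erase q, b k * X k ^ c i)) (k : Fin n) : f ∣ b k := by
  classical
  set N : Matrix (Fin (n + 1)) (Fin (n + 1)) (MvPolynomial (Fin n) ℤ) :=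
    of (Fin.cons u fun k i => if k = q then (c i : MvPolynomial (Fin n) ℤ) * X p ^ c i else X k ^ c i)
    with hNdef
  have hN0 : ∀ i, N 0 i = u i := fun i => rfl
  have hNs : ∀ (k : Fin n) i, N k.succ i =
    if k = q then (c i : MvPolynomial (Fin n) ℤ) * X p ^ c i else X k ^ c i := fun k i => rfl
  -- the determinant does not involve `X q`
  have hX : ∀ k, k ≠ q → X k ∈ supported ℤ ({q}ᶜ : Set (Fin n)) := fun k hk => X_mem_supported.2 hk
  have hu' : ∀ i, u i ∈ supported ℤ ({q}ᶜ : Set (Fin n)) := by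
    intro i
    rcases hu with rfl | ⟨p', hp', -, rfl⟩
    · exact pow_mem (Subalgebra.algebraMap_mem _ _) _
    · exact mul_mem (natCast_mem _ _) (pow_mem (hX _ hp') _)
  have hmem : N.det ∈ supported ℤ ({q}ᶜ : Set (Fin n)) := by
    rw [det_apply]
    refine sum_mem fun σ _ => ?_
    rw [Units.smul_def]
    refine zsmul_mem (prod_mem fun i _ => ?_) _
    refine Fin.cases ?_ (fun k => ?_) (σ i)
    · exact hu' i
    · rw [hNs]
      split_ifs with h
      · exact mul_mem (natCast_mem _ _) (pow_mem (hX _ hp) _)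
      · exact pow_mem (hX _ h) _
  have hvars : q ∉ N.det.vars := fun h => (mem_supported.1 hmem h) rfl
  -- it is nonzero, since it is nonzero at the point `(1, …, n)`
  have hdet : N.det ≠ 0 := by
    intro h0
    set φ : MvPolynomial (Fin n) ℤ →+* ℚ := (aeval fun k : Fin n => ((k : ℕ) : ℚ) + 1).toRingHom
      with hφ
    have hφX : ∀ k, φ (X k) = ((k : ℕ) : ℚ) + 1 := fun k => by simp [hφ]
    have hφC : ∀ z : ℤ, φ (C z) = z := fun z => by simp [hφ]
    have h1 : (φ.mapMatrix N).det = 0 := by rw [← RingHom.map_det, h0, map_zero]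
    obtain ⟨v, hv0, hv⟩ := exists_mulVec_eq_zero_iff.2 h1
    have hrow : ∀ j, ∑ i, φ (N j i) * v i = 0 := fun j => congrFun hv j
    have hinj : Function.Injective fun k : Fin n => ((k : ℕ) : ℚ) + 1 := by
      intro k k' h
      have : ((k : ℕ) : ℚ) = (k' : ℕ) := by simpa using h
      exact Fin.ext (by exact_mod_cast this)
    -- the double root `p`
    have hprow : ∑ i, (c i : ℚ) * (((p : ℕ) : ℚ) + 1) ^ c i * v i = 0 := by
      have := hrow q.succ
      simpa [hNs, hφX] using this
    have hkrow : ∀ k, k ≠ q → ∑ i, (((k : ℕ) : ℚ) + 1) ^ c i * v i = 0 := by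
      intro k hk
      have := hrow k.succ
      simpa [hNs, hφX, hk] using this
    have hcardT : ((Finset.univ.erase q).image fun k : Fin n => ((k : ℕ) : ℚ) + 1).card = n - 1 := by
      rw [Finset.card_image_of_injective _ hinj, Finset.card_erase_of_mem (Finset.mem_univ _)]
      simp
    have hn := q.pos
    refine hv0 ?_
    rcases hu with hu | ⟨p', hp'q, hp'p, hu⟩
    · have hurow : ∑ i, ((n : ℚ) + 1) ^ c i * v i = 0 := by
        have := hrow 0
        simpa [hN0, hu, hφC] using this
      refine eq_zero_of_sum_mul_pow_eq_zero hc
        (T := insert ((n : ℚ) + 1) ((Finset.univ.erase q).image fun k : Fin n => ((k : ℕ) : ℚ) + 1))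
        (T' := {((p : ℕ) : ℚ) + 1}) ?_ ?_ ?_ ?_ ?_
      · intro y hy
        rw [Finset.mem_singleton] at hy
        subst hy
        exact Finset.mem_insert_of_mem (Finset.mem_image_of_mem _ (by simp [hp]))
      · intro y hy
        rcases Finset.mem_insert.1 hy with rfl | hy
        · positivity
        · obtain ⟨k, -, rfl⟩ := Finset.mem_image.1 hy
          positivity
      · rw [Finset.card_insert_of_notMem, hcardT, Finset.card_singleton]
        · omega
        · intro h
          obtain ⟨k, -, hk⟩ := Finset.mem_image.1 h
          have : ((k : ℕ) : ℚ) = n := by simpa using hk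
          have : (k : ℕ) = n := by exact_mod_cast this
          omega
      · intro y hy
        rcases Finset.mem_insert.1 hy with rfl | hy
        · exact hurow
        · obtain ⟨k, hk, rfl⟩ := Finset.mem_image.1 hy
          exact hkrow k (Finset.ne_of_mem_erase hk)
      · intro y hy
        rw [Finset.mem_singleton] at hy
        subst hy
        exact hprow
    · have hurow : ∑ i, (c i : ℚ) * (((p' : ℕ) : ℚ) + 1) ^ c i * v i = 0 := by
        have := hrow 0
        simpa [hN0, hu, hφX] using this
      refine eq_zero_of_sum_mul_pow_eq_zero hc
        (T := (Finset.univ.erase q).image fun k : Fin n => ((k : ℕ) : ℚ) + 1)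
        (T' := {((p : ℕ) : ℚ) + 1, ((p' : ℕ) : ℚ) + 1}) ?_ ?_ ?_ ?_ ?_
      · intro y hy
        rw [Finset.mem_insert, Finset.mem_singleton] at hy
        rcases hy with rfl | rfl
        · exact Finset.mem_image_of_mem _ (by simp [hp])
        · exact Finset.mem_image_of_mem _ (by simp [hp'q])
      · intro y hy
        obtain ⟨k, -, rfl⟩ := Finset.mem_image.1 hy
        positivity
      · rw [hcardT, Finset.card_pair (hinj.ne hp'p.symm)]
        omega
      · intro y hy
        obtain ⟨k, hk, rfl⟩ := Finset.mem_image.1 hy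
        exact hkrow k (Finset.ne_of_mem_erase hk)
      · intro y hy
        rw [Finset.mem_insert, Finset.mem_singleton] at hy
        rcases hy with rfl | rfl
        · exact hprow
        · exact hurow
  have hnd : ¬ f ∣ N.det := fun h => notMem_vars_of_dvd h hdet hvars hq
  have := dvd_of_dvd_vecMul hf hnd (v := Fin.cons b₀ b) (fun i => ?_) k.succ
  · simpa using this
  · convert hb i using 1
    simp only [vecMul, dotProduct, Fin.sum_univ_succ, Fin.cons_zero, Fin.cons_succ, hN0, hNs]
    rw [← Finset.add_sum_erase _ _ (Finset.mem_univ q), if_pos rfl]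
    congr 2
    exact Finset.sum_congr rfl fun k hk => by rw [if_neg (Finset.ne_of_mem_erase hk)]

/-- The special case of `dvd_of_relation` without a further row. -/
theorem dvd_of_relation' {f : MvPolynomial (Fin n) ℤ} (hf : Prime f) {q p : Fin n}
    (hq : q ∈ f.vars) (hp : p ≠ q) {c : Fin (n + 1) → ℕ} (hc : Function.Injective c)
    {b : Fin n → MvPolynomial (Fin n) ℤ}
    (hb : ∀ i, f ∣ b q * ((c i : MvPolynomial (Fin n) ℤ) * X p ^ c i) +
      ∑ k ∈ Finset.univ.erase q, b k * X k ^ c i) (k : Fin n) : f ∣ b k :=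
  dvd_of_relation hf hq hp hc (Or.inl rfl) (b₀ := 0)
    (fun i => by rw [zero_mul, zero_add]; exact hb i) k

/-- If all maximal minors of an `n × (n + 1)` matrix are divisible by the prime `f`, then its rows
are linearly dependent modulo `f`. -/
theorem exists_relation_of_dvd_minors {A : Type*} [CommRing A] {f : A} (hf : Prime f)
    {N : Matrix (Fin n) (Fin (n + 1)) A}
    (hN : ∀ i : Fin (n + 1), f ∣ (of fun k j => N k (i.succAbove j)).det) :
    ∃ a : Fin n → A, (∃ k, ¬ f ∣ a k) ∧ ∀ i, f ∣ ∑ k, a k * N k i := by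
  have : IsDomain (A ⧸ Ideal.span {f}) :=
    (Ideal.Quotient.isDomain_iff_prime _).2 ((Ideal.span_singleton_prime hf.ne_zero).2 hf)
  have hdvd : ∀ a, Ideal.Quotient.mk (Ideal.span {f}) a = 0 ↔ f ∣ a := fun a => by
    rw [Ideal.Quotient.eq_zero_iff_mem, Ideal.mem_span_singleton]
  set B := A ⧸ Ideal.span {f}
  set φ := Ideal.Quotient.mk (Ideal.span {f})
  set K := FractionRing B
  set ψ : A →+* K := (algebraMap B K).comp φ with hψ
  have hψ0 : ∀ a, ψ a = 0 ↔ f ∣ a := fun a => by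
    rw [hψ, RingHom.comp_apply, ← hdvd, map_eq_zero_iff _ (IsFractionRing.injective B K)]
  -- the rows over the field of fractions are dependent, for otherwise some standard basis vector
  -- extends them to a basis and one of the minors is not zero
  have hdep : ¬ LinearIndependent K (fun k i => ψ (N k i) : Fin n → Fin (n + 1) → K) := by
    intro hli
    have hne : ∃ j : Fin (n + 1), (Pi.single j 1 : Fin (n + 1) → K) ∉
        Submodule.span K (Set.range (fun k i => ψ (N k i) : Fin n → Fin (n + 1) → K)) := by
      by_contra! hall
      have htop : Submodule.span K (Set.range (fun k i => ψ (N k i) : Fin n → Fin (n + 1) → K)) =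
          ⊤ := by
        rw [eq_top_iff, ← (Pi.basisFun K (Fin (n + 1))).span_eq, Submodule.span_le]
        rintro _ ⟨j, rfl⟩
        rw [Pi.basisFun_apply]
        exact hall j
      have h1 := finrank_span_eq_card hli
      rw [htop, finrank_top, Module.finrank_fin_fun, Fintype.card_fin] at h1
      omega
    obtain ⟨j, hj⟩ := hne
    have hli' := linearIndependent_finCons.2 ⟨hli, hj⟩
    set N' : Matrix (Fin (n + 1)) (Fin (n + 1)) K :=
      of (Fin.cons (Pi.single j 1) fun k i => ψ (N k i)) with hN'
    have hunit : IsUnit N' := (linearIndependent_rows_iff_isUnit (A := N')).1 hli'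
    have hdet : N'.det ≠ 0 := ((isUnit_iff_isUnit_det N').1 hunit).ne_zero
    refine hdet ?_
    rw [det_succ_row_zero]
    refine Finset.sum_eq_zero fun i _ => ?_
    have h1 : N'.submatrix Fin.succ i.succAbove = ψ.mapMatrix (of fun k j => N k (i.succAbove j)) := by
      ext k l
      simp [hN']
    rw [h1, ← RingHom.map_det, (hψ0 _).2 (hN i), mul_zero]
  have hdep' : ¬ LinearIndependent B
      (fun k i => algebraMap B K (φ (N k i)) : Fin n → Fin (n + 1) → K) :=
    fun h => hdep ((LinearIndependent.iff_fractionRing B K).1 h)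
  rw [Fintype.not_linearIndependent_iff] at hdep'
  obtain ⟨g, hg, k, hk⟩ := hdep'
  choose a ha using fun k => Ideal.Quotient.mk_surjective (g k)
  refine ⟨a, ⟨k, fun h => hk ?_⟩, fun i => ?_⟩
  · rw [← ha, (hdvd _).2 h]
  · have h1 := congrFun hg i
    rw [Finset.sum_apply, Pi.zero_apply] at h1
    rw [← hdvd, ← map_eq_zero_iff _ (IsFractionRing.injective B K), map_sum, map_sum, ← h1]
    refine Finset.sum_congr rfl fun k _ => ?_
    rw [map_mul, map_mul, ha, Pi.smul_apply, Algebra.smul_def]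

/-- Alternants with distinct exponents are not divisible by a constant prime. -/
theorem not_dvd_det_of_vars_eq_empty {f : MvPolynomial (Fin n) ℤ} (hf : Prime f)
    (hv : f.vars = ∅) {c : Fin n → ℕ} (hc : Function.Injective c) :
    ¬ f ∣ (of fun k j => X k ^ c j : Matrix (Fin n) (Fin n) (MvPolynomial (Fin n) ℤ)).det := by
  classical
  intro h
  rw [vars_eq_empty_iff_eq_C.1 hv, C_dvd_iff_dvd_coeff] at h
  set m : Equiv.Perm (Fin n) → (Fin n →₀ ℕ) := fun σ => ∑ k, Finsupp.single (σ k) (c k)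
  have hm : ∀ σ k, m σ (σ k) = c k := by
    intro σ k
    simp only [m, Finsupp.finsetSum_apply]
    rw [Finset.sum_eq_single k]
    · simp
    · intro k' _ hk'
      rw [Finsupp.single_apply, if_neg (σ.injective.ne hk')]
    · simp
  have hcoeff : coeff (m 1) (of fun k j => X k ^ c j :
      Matrix (Fin n) (Fin n) (MvPolynomial (Fin n) ℤ)).det = 1 := by
    rw [det_apply, coeff_sum, Finset.sum_eq_single 1]
    · have : (∏ i : Fin n, (X i ^ c i : MvPolynomial (Fin n) ℤ)) = monomial (m 1) 1 := by
        simp only [m, X_pow_eq_monomial, Equiv.Perm.one_apply]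
        rw [monomial_sum_one]
      simp [this]
    · intro σ _ hσ
      have : (∏ i : Fin n, (X (σ i) ^ c i : MvPolynomial (Fin n) ℤ)) = monomial (m σ) 1 := by
        simp only [m, X_pow_eq_monomial]
        rw [monomial_sum_one]
      simp only [of_apply]
      rw [this, Units.smul_def, coeff_smul, coeff_monomial, if_neg, smul_zero]
      intro h
      refine hσ (Equiv.ext fun k => hc ?_)
      have h1 := hm σ k
      have h2 := hm 1 (σ k)
      rw [h] at h1
      exact h2.symm.trans h1
    · simp
  have h1 := h (m 1)
  rw [hcoeff] at h1
  refine hf.not_isUnit ?_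
  rw [vars_eq_empty_iff_eq_C.1 hv]
  exact (isUnit_of_dvd_one h1).map C

/-- A derivation that sends `X k` to `g k * X k` sends a relation between the rows `(X k ^ c i)_i`
modulo `f` to a relation that involves the rows of derivatives. -/
theorem dvd_derivation_relation {f : MvPolynomial (Fin n) ℤ} {ι : Type*} {c : ι → ℕ}
    {a : Fin n → MvPolynomial (Fin n) ℤ} (h : ∀ i, f ∣ ∑ k, a k * X k ^ c i)
    (E : Derivation ℤ (MvPolynomial (Fin n) ℤ) (MvPolynomial (Fin n) ℤ))
    (hE : f ∣ E f) {g : Fin n → MvPolynomial (Fin n) ℤ} (hg : ∀ k, E (X k) = g k * X k) (i : ι) :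
    f ∣ ∑ k, E (a k) * X k ^ c i +
      ∑ k, a k * g k * ((c i : MvPolynomial (Fin n) ℤ) * X k ^ c i) := by
  have hpow : ∀ k, E (X k ^ c i) = g k * ((c i : MvPolynomial (Fin n) ℤ) * X k ^ c i) := by
    intro k
    rw [Derivation.leibniz_pow, hg, smul_eq_mul, nsmul_eq_mul]
    rcases Nat.eq_zero_or_pos (c i) with h0 | h0
    · simp [h0]
    · calc (c i : MvPolynomial (Fin n) ℤ) * ((X k : MvPolynomial (Fin n) ℤ) ^ (c i - 1) * (g k * X k))
          = g k * ((c i : MvPolynomial (Fin n) ℤ) * X k ^ (c i - 1 + 1)) := by ring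
        _ = _ := by rw [Nat.sub_add_cancel h0]
  obtain ⟨t, ht⟩ := h i
  have h1 : E (∑ k, a k * X k ^ c i) = E (f * t) := by rw [ht]
  rw [map_sum, Derivation.leibniz] at h1
  simp only [Derivation.leibniz, smul_eq_mul, hpow] at h1
  have h2 : ∑ k, E (a k) * X k ^ c i +
      ∑ k, a k * g k * ((c i : MvPolynomial (Fin n) ℤ) * X k ^ c i) = f * E t + t * E f := by
    rw [← h1, ← Finset.sum_add_distrib]
    exact Finset.sum_congr rfl fun k _ => by ring
  rw [h2]
  exact dvd_add (dvd_mul_right _ _) (hE.mul_left _)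

/-- Elimination of the row `w q` from two relations modulo `f`, the second of which has the
additional term `z`. -/
theorem dvd_sum_erase {A ι κ : Type*} [CommRing A] [Fintype κ] [DecidableEq κ] {f : A}
    {w : κ → ι → A} {a a' : κ → A} {z : ι → A} (h : ∀ i, f ∣ ∑ k, a k * w k i)
    (h' : ∀ i, f ∣ ∑ k, a' k * w k i + z i) (q : κ) (i : ι) :
    f ∣ a q * z i + ∑ k ∈ Finset.univ.erase q, (a q * a' k - a' q * a k) * w k i := by
  have h1 := dvd_sub ((h' i).mul_left (a q)) ((h i).mul_left (a' q))
  rw [← Finset.add_sum_erase _ (fun k => a' k * w k i) (Finset.mem_univ q),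
    ← Finset.add_sum_erase _ (fun k => a k * w k i) (Finset.mem_univ q)] at h1
  convert h1 using 1
  have h2 : ∑ k ∈ Finset.univ.erase q, (a q * a' k - a' q * a k) * w k i =
      a q * ∑ k ∈ Finset.univ.erase q, a' k * w k i -
        a' q * ∑ k ∈ Finset.univ.erase q, a k * w k i := by
    rw [Finset.mul_sum, Finset.mul_sum, ← Finset.sum_sub_distrib]
    exact Finset.sum_congr rfl fun k _ => by ring
  rw [h2]
  ring

section Relation

variable {f : MvPolynomial (Fin n) ℤ} {c : Fin (n + 1) → ℕ} {a : Fin n → MvPolynomial (Fin n) ℤ}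

/-- Each variable of `f` occurs in each relation modulo `f`: without it the rows are
independent. -/
theorem not_dvd_of_mem_vars (hf : Prime f) (hc : Function.Injective c)
    (ha : ∃ k, ¬ f ∣ a k) (h : ∀ i, f ∣ ∑ k, a k * X k ^ c i) {q : Fin n} (hq : q ∈ f.vars) :
    ¬ f ∣ a q := by
  classical
  intro hdvd
  obtain ⟨p, hp⟩ := ha
  have hpq : p ≠ q := fun h => hp (h ▸ hdvd)
  refine hp ?_
  have := dvd_of_relation' hf hq hpq hc (b := Function.update a q 0) (fun i => ?_) p
  · rwa [Function.update_of_ne hpq] at this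
  · rw [Function.update_self, zero_mul, zero_add]
    have h1 := h i
    rw [← Finset.add_sum_erase _ _ (Finset.mem_univ q)] at h1
    convert (dvd_add_right (hdvd.mul_right _)).1 h1 using 1
    exact Finset.sum_congr rfl fun k hk => by
      rw [Function.update_of_ne (Finset.ne_of_mem_erase hk)]

/-- Conversely, `f` involves each variable that occurs in a relation modulo `f`: otherwise the
derivation with respect to this variable kills `f` and produces a second relation, from which a
variable of `f` can be eliminated. -/
theorem mem_vars_of_not_dvd (hf : Prime f) (hc : Function.Injective c)
    (h : ∀ i, f ∣ ∑ k, a k * X k ^ c i) {q : Fin n} (hq : q ∈ f.vars) {p : Fin n}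
    (hp : ¬ f ∣ a p) : p ∈ f.vars := by
  classical
  by_contra hpv
  have hpq : p ≠ q := fun h => hpv (h ▸ hq)
  have haq := not_dvd_of_mem_vars hf hc ⟨p, hp⟩ h hq
  set E : Derivation ℤ (MvPolynomial (Fin n) ℤ) (MvPolynomial (Fin n) ℤ) :=
    (X p : MvPolynomial (Fin n) ℤ) • pderiv p with hE
  have hEf : E f = 0 := by
    rw [hE, Derivation.smul_apply, pderiv_eq_zero_of_notMem_vars hpv, smul_zero]
  have h1 := dvd_derivation_relation h E (hEf ▸ dvd_zero f) (g := Pi.single p 1) (fun k => by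
    rw [hE, Derivation.smul_apply, pderiv_X, smul_eq_mul]
    by_cases hk : k = p
    · subst hk; simp
    · rw [Pi.single_eq_of_ne hk, mul_zero, zero_mul])
  have h2 := dvd_sum_erase h h1 q
  have h3 := dvd_of_relation' hf hq hpq hc
    (b := Function.update (fun k => a q * E (a k) - E (a q) * a k) q (a q * a p)) (fun i => ?_) q
  · rw [Function.update_self] at h3
    exact (hf.dvd_or_dvd h3).elim haq hp
  · convert h2 i using 1
    refine congrArg₂ (· + ·) ?_ ?_
    · rw [Function.update_self, Finset.sum_eq_single p]
      · rw [Pi.single_eq_same]; ring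
      · intro k _ hk
        rw [Pi.single_eq_of_ne hk]; ring
      · simp
    · exact Finset.sum_congr rfl fun k hk => by
        rw [Function.update_of_ne (Finset.ne_of_mem_erase hk)]

/-- A prime polynomial modulo which the rows `(X k ^ c i)_i` are dependent involves at most two
variables: otherwise a derivation that kills it produces a second relation, which involves two
rows of derivatives, and a third variable can be eliminated from the two relations. -/
theorem eq_or_eq_of_mem_vars (hf : Prime f) (hc : Function.Injective c)
    (ha : ∃ k, ¬ f ∣ a k) (h : ∀ i, f ∣ ∑ k, a k * X k ^ c i) {q p : Fin n} (hq : q ∈ f.vars)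
    (hp : p ∈ f.vars) (hpq : p ≠ q) {p' : Fin n} (hp' : p' ∈ f.vars) : p' = q ∨ p' = p := by
  classical
  by_contra! hne
  obtain ⟨hp'q, hp'p⟩ := hne
  set E : Derivation ℤ (MvPolynomial (Fin n) ℤ) (MvPolynomial (Fin n) ℤ) :=
    (X p' * pderiv p' f) • ((X p : MvPolynomial (Fin n) ℤ) • pderiv p) -
      (X p * pderiv p f) • ((X p' : MvPolynomial (Fin n) ℤ) • pderiv p') with hE
  have hEapp : ∀ x, E x = X p' * pderiv p' f * (X p * pderiv p x) -
      X p * pderiv p f * (X p' * pderiv p' x) := fun x => by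
    simp [hE, smul_eq_mul]
  have hEf : E f = 0 := by
    rw [hEapp]
    ring
  have h1 := dvd_derivation_relation h E (hEf ▸ dvd_zero f)
    (g := Pi.single p (X p' * pderiv p' f) - Pi.single p' (X p * pderiv p f)) (fun k => by
    rw [hEapp, pderiv_X, pderiv_X, Pi.sub_apply]
    by_cases hk : k = p
    · subst hk
      rw [Pi.single_eq_same, Pi.single_eq_same, Pi.single_eq_of_ne (Ne.symm hp'p),
        Pi.single_eq_of_ne (Ne.symm hp'p)]
      ring
    · by_cases hk' : k = p'
      · subst hk'
        rw [Pi.single_eq_same, Pi.single_eq_same, Pi.single_eq_of_ne hk,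
          Pi.single_eq_of_ne hk]
        ring
      · rw [Pi.single_eq_of_ne hk, Pi.single_eq_of_ne hk, Pi.single_eq_of_ne hk',
          Pi.single_eq_of_ne hk']
        ring)
  have h2 := dvd_sum_erase h h1 q
  have h3 := dvd_of_relation hf hq hpq hc (Or.inr ⟨p', hp'q, hp'p, rfl⟩)
    (b₀ := -(a q * (a p' * (X p * pderiv p f))))
    (b := Function.update (fun k => a q * E (a k) - E (a q) * a k) q
      (a q * (a p * (X p' * pderiv p' f)))) (fun i => ?_) q
  · rw [Function.update_self] at h3
    have haq := not_dvd_of_mem_vars hf hc ha h hq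
    have hap := not_dvd_of_mem_vars hf hc ha h hp
    have hXp' : ¬ f ∣ X p' := fun h =>
      notMem_vars_of_dvd h (X_ne_zero _) (by rw [vars_X]; simpa using Ne.symm hp'q) hq
    rcases hf.dvd_or_dvd h3 with h4 | h4
    · exact haq h4
    · rcases hf.dvd_or_dvd h4 with h4 | h4
      · exact hap h4
      · rcases hf.dvd_or_dvd h4 with h4 | h4
        · exact hXp' h4
        · exact not_dvd_pderiv hp' h4
  · convert h2 i using 1
    rw [← add_assoc]
    refine congrArg₂ (· + ·) ?_ ?_
    · rw [Function.update_self]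
      simp only [Pi.sub_apply, mul_sub, sub_mul, Finset.sum_sub_distrib]
      rw [Finset.sum_eq_single p, Finset.sum_eq_single p', Pi.single_eq_same, Pi.single_eq_same]
      · ring
      · intro k _ hk
        rw [Pi.single_eq_of_ne hk]; ring
      · simp
      · intro k _ hk
        rw [Pi.single_eq_of_ne hk]; ring
      · simp
    · exact Finset.sum_congr rfl fun k hk => by
        rw [Function.update_of_ne (Finset.ne_of_mem_erase hk)]

end Relation

/-! ### Coprimality of the Schur polynomials of a sequence of exponents -/

/-- In a domain, if `x ^ c i = y ^ c i` for all `i`, then also `x ^ r = y ^ r` for the greatest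
common divisor `r` of the `c i`. -/
theorem pow_eq_pow_of_forall {A ι : Type*} [CommRing A] [IsDomain A] {x y : A} (hy : y ≠ 0)
    {c : ι → ℕ} {r : ℕ} (hr : ∀ D, (∀ i, D ∣ c i) → D ∣ r) (h : ∀ i, x ^ c i = y ^ c i) :
    x ^ r = y ^ r := by
  set φ := algebraMap A (FractionRing A)
  have hφ : Function.Injective φ := IsFractionRing.injective A (FractionRing A)
  have hφy : φ y ≠ 0 := fun h0 => hy (hφ (by rw [h0, map_zero]))
  have h1 : ∀ i, orderOf (φ x / φ y) ∣ c i := fun i => by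
    rw [orderOf_dvd_iff_pow_eq_one, div_pow, ← map_pow, h i, map_pow, div_self (pow_ne_zero _ hφy)]
  have h2 := orderOf_dvd_iff_pow_eq_one.1 (hr _ h1)
  rw [div_pow, div_eq_one_iff_eq (pow_ne_zero _ hφy), ← map_pow, ← map_pow] at h2
  exact hφ h2

theorem dvd_pow_sub_pow_of_forall {A ι : Type*} [CommRing A] {f x y : A} (hf : Prime f)
    (hy : ¬ f ∣ y) {c : ι → ℕ} {r : ℕ} (hr : ∀ D, (∀ i, D ∣ c i) → D ∣ r)
    (h : ∀ i, f ∣ x ^ c i - y ^ c i) : f ∣ x ^ r - y ^ r := by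
  have : IsDomain (A ⧸ Ideal.span {f}) :=
    (Ideal.Quotient.isDomain_iff_prime _).2 ((Ideal.span_singleton_prime hf.ne_zero).2 hf)
  have hdvd : ∀ a, Ideal.Quotient.mk (Ideal.span {f}) a = 0 ↔ f ∣ a := fun a => by
    rw [Ideal.Quotient.eq_zero_iff_mem, Ideal.mem_span_singleton]
  have h1 := pow_eq_pow_of_forall (x := Ideal.Quotient.mk (Ideal.span {f}) x)
    (y := Ideal.Quotient.mk (Ideal.span {f}) y) (fun h0 => hy ((hdvd y).1 h0)) hr (fun i => by
      rw [← map_pow, ← map_pow, ← sub_eq_zero, ← map_sub, hdvd]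
      exact h i)
  rw [← map_pow, ← map_pow, ← sub_eq_zero, ← map_sub, hdvd] at h1
  exact h1

/-- Modulo `x ^ r - y ^ r`, the quotient of `x ^ (r c) - y ^ (r c)` by `x ^ r - y ^ r` is
`c y ^ (r (c - 1))`. -/
theorem dvd_mul_geom_sum₂_sub {A : Type*} [CommRing A] {f x y : A} (r c : ℕ)
    (h : f ∣ x ^ r - y ^ r) :
    f ∣ (r : A) * y ^ r * ∑ t ∈ Finset.range c, (x ^ r) ^ t * (y ^ r) ^ (c - 1 - t) -
      ((r * c : ℕ) : A) * y ^ (r * c) := by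
  have hterm : ∀ t ∈ Finset.range c, f ∣ y ^ r * ((x ^ r) ^ t * (y ^ r) ^ (c - 1 - t)) -
      (y ^ r) ^ c := by
    intro t ht
    rw [Finset.mem_range] at ht
    have h1 : (y ^ r) ^ c = y ^ r * ((y ^ r) ^ t * (y ^ r) ^ (c - 1 - t)) := by
      rw [← pow_add, ← pow_succ']
      congr 1
      omega
    rw [h1, ← mul_sub, ← sub_mul]
    exact Dvd.dvd.mul_left (Dvd.dvd.mul_right (h.trans (sub_dvd_pow_sub_pow _ _ _)) _) _
  have h2 := (Finset.dvd_sum hterm).mul_left (r : A)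
  convert h2 using 1
  rw [Finset.sum_sub_distrib, ← Finset.mul_sum, Finset.sum_const, Finset.card_range, nsmul_eq_mul,
    pow_mul]
  push_cast
  ring

theorem exists_diffProd_eq_mul {A : Type*} [CommRing A] (x : Fin n → A) {p q : Fin n}
    (hpq : p ≠ q) : ∃ t, diffProd x = (x p - x q) * t := by
  rcases lt_or_gt_of_ne hpq with h | h
  · exact (Finset.dvd_prod_of_mem (fun j => x p - x j) (Finset.mem_Ioi.2 h)).trans
      (Finset.dvd_prod_of_mem (fun i => ∏ j ∈ Finset.Ioi i, (x i - x j)) (Finset.mem_univ p))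
  · obtain ⟨t, ht⟩ := (Finset.dvd_prod_of_mem (fun j => x q - x j) (Finset.mem_Ioi.2 h)).trans
      (Finset.dvd_prod_of_mem (fun i => ∏ j ∈ Finset.Ioi i, (x i - x j)) (Finset.mem_univ q))
    exact ⟨-t, by rw [diffProd, ht]; ring⟩

theorem X_pow_sub_X_pow_ne_zero {r : ℕ} (hr : 0 < r) {p q : Fin n} (hpq : p ≠ q) :
    (X p ^ r - X q ^ r : MvPolynomial (Fin n) ℤ) ≠ 0 := by
  intro h
  have h1 := congrArg (MvPolynomial.eval (Pi.single p 1)) h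
  simp [Pi.single_eq_of_ne hpq.symm, hr.ne'] at h1

theorem diffProd_X_pow_ne_zero {r : ℕ} (hr : 0 < r) :
    diffProd (fun k : Fin n => (X k ^ r : MvPolynomial (Fin n) ℤ)) ≠ 0 := by
  rw [diffProd, Finset.prod_ne_zero_iff]
  intro i _
  rw [Finset.prod_ne_zero_iff]
  intro j hj
  exact X_pow_sub_X_pow_ne_zero hr (Finset.mem_Ioi.1 hj).ne

/-- The quotients of the maximal minors of the matrix `(X k ^ (r * c i))` by the product of the
differences `X k ^ r - X l ^ r` have no common prime factor, if the `c i` have greatest common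
divisor `1`. -/
theorem exists_not_dvd_of_prime {r : ℕ} (hr0 : 0 < r) {c : Fin (n + 1) → ℕ}
    (hc : Function.Injective c) (hlast : c (Fin.last n) = 0)
    (hr : ∀ D, (∀ i, D ∣ r * c i) → D ∣ r) {s : Fin (n + 1) → MvPolynomial (Fin n) ℤ}
    (hs : ∀ i, diffProd (fun k : Fin n => (X k ^ r : MvPolynomial (Fin n) ℤ)) * s i =
      (of fun k j => X k ^ (r * c (i.succAbove j)) : Matrix (Fin n) (Fin n) _).det)
    {f : MvPolynomial (Fin n) ℤ} (hf : Prime f) : ∃ i, ¬ f ∣ s i := by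
  classical
  by_contra! hall
  have hrc : Function.Injective fun i => r * c i := fun i j h =>
    hc (Nat.eq_of_mul_eq_mul_left hr0 h)
  have hD : ∀ i : Fin (n + 1), f ∣
      (of fun k j => X k ^ (r * c (i.succAbove j)) : Matrix (Fin n) (Fin n) _).det :=
    fun i => hs i ▸ (hall i).mul_left _
  rcases f.vars.eq_empty_or_nonempty with hv | ⟨q, hq⟩
  · exact not_dvd_det_of_vars_eq_empty hf hv
      (hrc.comp (Fin.succAbove_right_injective (p := Fin.last n))) (hD (Fin.last n))
  obtain ⟨a, ha, h⟩ := exists_relation_of_dvd_minors hf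
    (N := of fun k i => (X k ^ (r * c i) : MvPolynomial (Fin n) ℤ)) hD
  simp only [of_apply] at h
  have haq := not_dvd_of_mem_vars hf hrc ha h hq
  have h0 : f ∣ ∑ k, a k := by
    have := h (Fin.last n)
    simpa [hlast] using this
  -- the relation involves exactly two variables
  obtain ⟨p, hpq, hap⟩ : ∃ p, p ≠ q ∧ ¬ f ∣ a p := by
    by_contra! hcon
    rw [← Finset.add_sum_erase _ _ (Finset.mem_univ q)] at h0
    exact haq ((dvd_add_left (Finset.dvd_sum fun k hk => hcon k (Finset.ne_of_mem_erase hk))).1 h0)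
  have hpv := mem_vars_of_not_dvd hf hrc h hq hap
  have hother : ∀ k, k ≠ q → k ≠ p → f ∣ a k := by
    intro k hkq hkp
    by_contra hk
    exact (eq_or_eq_of_mem_vars hf hrc ha h hq hpv hpq (mem_vars_of_not_dvd hf hrc h hq hk)).elim
      hkq hkp
  have hpair : ∀ z : Fin n → MvPolynomial (Fin n) ℤ, f ∣ ∑ k, a k * z k →
      f ∣ a q * z q + a p * z p := by
    intro z hz
    rw [← Finset.add_sum_erase _ _ (Finset.mem_univ q), ← Finset.add_sum_erase _ _
      (Finset.mem_erase.2 ⟨hpq, Finset.mem_univ p⟩), ← add_assoc] at hz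
    refine (dvd_add_left (Finset.dvd_sum fun k hk => ?_)).1 hz
    rw [Finset.mem_erase, Finset.mem_erase] at hk
    exact (hother k hk.2.1 hk.1).mul_right _
  have hXq : ¬ f ∣ X q := fun h =>
    notMem_vars_of_dvd h (X_ne_zero _) (by rw [vars_X]; simpa using hpq) hpv
  -- hence `f` divides `X p ^ r - X q ^ r`
  have hpow : f ∣ X p ^ r - X q ^ r := by
    refine dvd_pow_sub_pow_of_forall hf hXq hr fun i => ?_
    have h1 := hpair (fun k => X k ^ (r * c i)) (h i)
    have h2 := hpair (fun _ => 1) (by simpa using h0)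
    have h3 := dvd_sub h1 (h2.mul_right (X q ^ (r * c i)))
    refine (hf.dvd_or_dvd (a := a p) ?_).resolve_left hap
    convert h3 using 1
    ring
  -- and it still divides the minors after division by this difference
  set g : Fin (n + 1) → MvPolynomial (Fin n) ℤ := fun i =>
    ∑ t ∈ Finset.range (c i), (X p ^ r) ^ t * (X q ^ r) ^ (c i - 1 - t) with hg
  obtain ⟨t, ht⟩ := exists_diffProd_eq_mul
    (fun k : Fin n => (X k ^ r : MvPolynomial (Fin n) ℤ)) hpq
  have hD' : ∀ i : Fin (n + 1), f ∣ (of fun k j => if k = p then g (i.succAbove j) else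
      X k ^ (r * c (i.succAbove j)) : Matrix (Fin n) (Fin n) _).det := by
    intro i
    set W : Matrix (Fin n) (Fin n) (MvPolynomial (Fin n) ℤ) :=
      of fun k j => X k ^ (r * c (i.succAbove j)) with hW
    have h1 : W.det = (X p ^ r - X q ^ r) * (W.updateRow p fun j => g (i.succAbove j)).det := by
      rw [← det_updateRow_smul, ← det_updateRow_add_smul_self W hpq (-1)]
      congr 2
      funext j
      simp only [hW, hg, of_apply, Pi.add_apply, Pi.smul_apply, smul_eq_mul, pow_mul]
      rw [mul_comm (X p ^ r - X q ^ r) (Finset.sum _ _), geom_sum₂_mul]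
      ring
    have h2 : (W.updateRow p fun j => g (i.succAbove j)) = of fun k j =>
        if k = p then g (i.succAbove j) else X k ^ (r * c (i.succAbove j)) := by
      ext1 k j
      by_cases hk : k = p
      · subst hk; simp
      · simp [hk, hW]
    rw [← h2]
    have h3 := hs i
    rw [ht, h1, mul_assoc] at h3
    rw [← mul_left_cancel₀ (X_pow_sub_X_pow_ne_zero hr0 hpq) h3]
    exact (hall i).mul_left _
  -- which gives a relation with the row of derivatives for `X q`, but without `X p`
  obtain ⟨a', ⟨k, hk⟩, h'⟩ := exists_relation_of_dvd_minors hf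
    (N := of fun k i => if k = p then g i else (X k ^ (r * c i) : MvPolynomial (Fin n) ℤ)) hD'
  have hrel := dvd_of_relation' hf hpv hpq.symm hrc
    (b := fun k => if k = p then a' p else (r : MvPolynomial (Fin n) ℤ) * X q ^ r * a' k)
    (fun i => ?_) k
  · by_cases hkp : k = p
    · subst hkp
      rw [if_pos rfl] at hrel
      exact hk hrel
    · rw [if_neg hkp] at hrel
      rcases hf.dvd_or_dvd hrel with h1 | h1
      · rcases hf.dvd_or_dvd h1 with h2 | h2
        · refine notMem_vars_of_dvd h2 (Nat.cast_ne_zero.2 hr0.ne') ?_ hq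
          rw [← map_natCast (C : ℤ →+* MvPolynomial (Fin n) ℤ), vars_C]
          simp
        · exact hXq (hf.dvd_of_dvd_pow h2)
      · exact hk h1
  · have h1 := h' i
    simp only [of_apply] at h1
    rw [← Finset.add_sum_erase _ _ (Finset.mem_univ p), if_pos rfl] at h1
    have h2 := h1.mul_left ((r : MvPolynomial (Fin n) ℤ) * X q ^ r)
    have h3 : f ∣ a' p * ((r : MvPolynomial (Fin n) ℤ) * X q ^ r * g i -
        ((r * c i : ℕ) : MvPolynomial (Fin n) ℤ) * X q ^ (r * c i)) :=
      (dvd_mul_geom_sum₂_sub r (c i) hpow).mul_left (a' p)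
    have h4 := dvd_sub h2 h3
    convert h4 using 1
    have h5 : ∑ k ∈ Finset.univ.erase p, (if k = p then a' p else
        (r : MvPolynomial (Fin n) ℤ) * X q ^ r * a' k) * X k ^ (r * c i) =
        (r : MvPolynomial (Fin n) ℤ) * X q ^ r * ∑ k ∈ Finset.univ.erase p,
          a' k * if k = p then g i else X k ^ (r * c i) := by
      rw [Finset.mul_sum]
      refine Finset.sum_congr rfl fun k hk => ?_
      rw [if_neg (Finset.ne_of_mem_erase hk), if_neg (Finset.ne_of_mem_erase hk)]
      ring
    rw [if_pos rfl, h5]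
    ring

/-! ### The kernel of a generalized Vandermonde matrix -/

/-- Cancellation of a family without common prime factor. -/
theorem dvd_of_forall_dvd_mul {A ι : Type*} [CommRing A] [IsDomain A] [UniqueFactorizationMonoid A]
    {s : ι → A} (hs : ∀ f : A, Prime f → ∃ i, ¬ f ∣ s i) (hs0 : ∃ i, s i ≠ 0) (a : A) :
    ∀ b, (∀ i, a ∣ b * s i) → a ∣ b := by
  induction a using UniqueFactorizationMonoid.induction_on_prime with
  | h₁ =>
    intro b h
    obtain ⟨i, hi⟩ := hs0
    rw [zero_dvd_iff]
    exact (mul_eq_zero.1 (zero_dvd_iff.1 (h i))).resolve_right hi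
  | h₂ x hx => exact fun b _ => hx.dvd
  | h₃ a p ha hp ih =>
    intro b h
    obtain ⟨i, hi⟩ := hs p hp
    obtain ⟨b', rfl⟩ := (hp.dvd_or_dvd ((dvd_mul_right p a).trans (h i))).resolve_right hi
    refine mul_dvd_mul_left p (ih b' fun j => ?_)
    have := h j
    rw [mul_assoc] at this
    exact (mul_dvd_mul_iff_left hp.ne_zero).1 this

/-- Cramer's rule: the vectors in the kernel of an `n × (n + 1)` matrix are proportional to the
vector of its signed maximal minors. -/
theorem mul_det_eq_mul_det {A : Type*} [CommRing A] (N : Matrix (Fin n) (Fin (n + 1)) A)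
    {P : Fin (n + 1) → A} (hP : ∀ k, ∑ i : Fin (n + 1), (-1) ^ (i : ℕ) * (N k i * P i) = 0)
    (i j : Fin (n + 1)) :
    P j * (of fun k l => N k (i.succAbove l)).det = P i * (of fun k l => N k (j.succAbove l)).det := by
  classical
  set N' : Matrix (Fin (n + 1)) (Fin (n + 1)) A :=
    of (Fin.cons (Pi.single i 1) fun k => N k) with hN'
  have hsub : ∀ l : Fin (n + 1), N'.submatrix Fin.succ l.succAbove =
      of fun k m => N k (l.succAbove m) := by
    intro l
    ext k m
    simp [hN']
  set Q : Fin (n + 1) → A := fun l => (-1) ^ (l : ℕ) * P l with hQ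
  have hmul : N' *ᵥ Q = Pi.single 0 (Q i) := by
    funext k
    refine Fin.cases ?_ (fun k => ?_) k
    · simp [hN', mulVec, dotProduct, Pi.single_apply]
    · rw [Pi.single_eq_of_ne (Fin.succ_ne_zero k), ← hP k]
      simp only [hN', mulVec, dotProduct, of_apply, Fin.cons_succ, hQ]
      exact Finset.sum_congr rfl fun l _ => by ring
  have hdet : N'.det = (-1) ^ (i : ℕ) * (of fun k l => N k (i.succAbove l)).det := by
    rw [det_succ_row_zero, Finset.sum_eq_single i, hsub]
    · simp [hN']
    · intro l _ hl
      simp [hN', Pi.single_eq_of_ne hl]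
    · simp
  have h1 : (N'.adjugate *ᵥ (N' *ᵥ Q)) j = N'.det * Q j := by
    rw [mulVec_mulVec, adjugate_mul, smul_mulVec, one_mulVec]
    rfl
  rw [hmul, mulVec_single, Pi.smul_apply, col_apply, adjugate_fin_succ_eq_det_submatrix,
    Fin.succAbove_zero, hsub, hdet] at h1
  simp only [MulOpposite.smul_eq_mul_unop, MulOpposite.unop_op, hQ, Fin.val_zero, zero_add] at h1
  have hsq : ∀ m : ℕ, ((-1 : A) ^ m) * (-1) ^ m = 1 := fun m => by
    rw [← mul_pow]; simp
  calc P j * (of fun k l => N k (i.succAbove l)).det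
      = ((-1) ^ (i : ℕ) * (-1) ^ (i : ℕ)) * ((-1) ^ (j : ℕ) * (-1) ^ (j : ℕ)) *
        (P j * (of fun k l => N k (i.succAbove l)).det) := by rw [hsq, hsq]; ring
    _ = (-1) ^ (i : ℕ) * (-1) ^ (j : ℕ) *
        ((-1) ^ (i : ℕ) * (of fun k l => N k (i.succAbove l)).det * ((-1) ^ (j : ℕ) * P j)) := by
      ring
    _ = (-1) ^ (i : ℕ) * (-1) ^ (j : ℕ) *
        ((-1) ^ (j : ℕ) * (of fun k l => N k (j.succAbove l)).det * ((-1) ^ (i : ℕ) * P i)) := by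
      rw [← h1]
    _ = ((-1) ^ (i : ℕ) * (-1) ^ (i : ℕ)) * ((-1) ^ (j : ℕ) * (-1) ^ (j : ℕ)) *
        (P i * (of fun k l => N k (j.succAbove l)).det) := by ring
    _ = _ := by rw [hsq, hsq]; ring

/-- The vectors in the kernel of the generalized Vandermonde matrix `(X k ^ (r * c i))` are, up to
signs, the multiples of the vector of the Schur polynomials that are the quotients of its maximal
minors. -/
theorem exists_eq_mul_schurValue {r : ℕ} (hr0 : 0 < r) {c : Fin (n + 1) → ℕ}
    (hc : StrictAnti c) (hlast : c (Fin.last n) = 0)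
    (hr : ∀ D, (∀ i, D ∣ r * c i) → D ∣ r) {P : Fin (n + 1) → MvPolynomial (Fin n) ℤ}
    (hP : ∀ k, ∑ i : Fin (n + 1), (-1) ^ (i : ℕ) * (X k ^ (r * c i) * P i) = 0) :
    ∃ R : MvPolynomial (Fin n) ℤ, ∀ i, P i =
      R * schurValue n (fun k => X k ^ r) fun j => c (i.succAbove j) := by
  set s : Fin (n + 1) → MvPolynomial (Fin n) ℤ :=
    fun i => schurValue n (fun k => X k ^ r) fun j => c (i.succAbove j) with hsdef
  set V := diffProd (fun k : Fin n => (X k ^ r : MvPolynomial (Fin n) ℤ)) with hV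
  have hV0 : V ≠ 0 := diffProd_X_pow_ne_zero hr0
  have hs : ∀ i, V * s i =
      (of fun k j => X k ^ (r * c (i.succAbove j)) : Matrix (Fin n) (Fin n) _).det := by
    intro i
    have h := diffProd_mul_schurValue n (fun k => (X k ^ r : MvPolynomial (Fin n) ℤ))
      (fun j => c (i.succAbove j)) (hc.comp_strictMono (Fin.strictMono_succAbove i))
    simpa only [pow_mul] using h
  have hcop := fun f hf => exists_not_dvd_of_prime hr0 hc.injective hlast hr hs (f := f) hf
  have hprop : ∀ i j, P j * s i = P i * s j := by
    intro i j
    have h1 := mul_det_eq_mul_det (of fun k i => (X k ^ (r * c i) : MvPolynomial (Fin n) ℤ)) hP i j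
    simp only [of_apply] at h1
    rw [← hs, ← hs] at h1
    exact mul_left_cancel₀ hV0 (by linear_combination h1)
  have hs0 : ∃ i, s i ≠ 0 := by
    by_contra! h0
    obtain ⟨q, hq⟩ : ∃ f : MvPolynomial (Fin n) ℤ, Prime f :=
      ⟨C 2, (prime_C_iff _).2 Int.prime_two⟩
    obtain ⟨i, hi⟩ := hcop q hq
    exact hi (h0 i ▸ dvd_zero q)
  obtain ⟨i₀, hi₀⟩ := hs0
  obtain ⟨R, hR⟩ := dvd_of_forall_dvd_mul hcop ⟨i₀, hi₀⟩ (s i₀) (P i₀) fun i =>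
    ⟨P i, by rw [mul_comm (s i₀), hprop]⟩
  refine ⟨R, fun i => mul_right_cancel₀ hi₀ ?_⟩
  rw [hprop, hR]
  ring

end Relations

/-! ### Multigraded pieces of free modules -/

open MvPolynomial

section Graded

variable {𝕜 : Type*} [Field 𝕜] {n : ℕ}

/-- The weight that defines the `ℤ^n`-grading of the polynomial ring. -/
abbrev unitWeight (n : ℕ) : Fin n → Fin n → ℤ := fun k => Pi.single k 1

theorem weight_unitWeight (m : Fin n →₀ ℕ) (k : Fin n) :
    Finsupp.weight (unitWeight n) m k = m k := by
  rw [Finsupp.weight_apply, Finsupp.sum_fintype _ _ (by simp), Finset.sum_apply,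
    Finset.sum_eq_single k]
  · simp
  · intro j _ hj
    simp [Pi.single_eq_of_ne (Ne.symm hj)]
  · simp

/-- The exponent vector of multidegree `c`, for `c ≥ 0`. -/
noncomputable def expo (c : Fin n → ℤ) : Fin n →₀ ℕ := Finsupp.equivFunOnFinite.symm fun k => (c k).toNat

theorem expo_apply (c : Fin n → ℤ) (k : Fin n) : expo c k = (c k).toNat := rfl

theorem weight_expo {c : Fin n → ℤ} (hc : 0 ≤ c) : Finsupp.weight (unitWeight n) (expo c) = c := by
  funext k
  rw [weight_unitWeight, expo_apply, Int.toNat_of_nonneg (hc k)]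

theorem coeff_eq_zero_of_mem_polyGrading {c : Fin n → ℤ} {φ : MvPolynomial (Fin n) 𝕜}
    (hφ : φ ∈ polyGrading 𝕜 n c) {m : Fin n →₀ ℕ} {k : Fin n} (hm : (m k : ℤ) ≠ c k) :
    coeff m φ = 0 := by
  by_contra h
  have h1 := hφ h
  exact hm (by rw [← h1, weight_unitWeight])

theorem eq_monomial_of_mem_polyGrading {c : Fin n → ℤ} {φ : MvPolynomial (Fin n) 𝕜}
    (hφ : φ ∈ polyGrading 𝕜 n c) : φ = monomial (expo c) (coeff (expo c) φ) := by
  ext m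
  rw [coeff_monomial]
  split_ifs with h
  · rw [h]
  · obtain ⟨k, hk⟩ : ∃ k, expo c k ≠ m k := by
      by_contra! h'
      exact h (Finsupp.ext h')
    refine coeff_eq_zero_of_mem_polyGrading hφ (k := k) fun h' => hk ?_
    rw [expo_apply, ← h', Int.toNat_natCast]

theorem eq_zero_of_mem_polyGrading {c : Fin n → ℤ} {φ : MvPolynomial (Fin n) 𝕜}
    (hφ : φ ∈ polyGrading 𝕜 n c) (hc : ¬ 0 ≤ c) : φ = 0 := by
  obtain ⟨k, hk⟩ : ∃ k, c k < 0 := by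
    by_contra! h
    exact hc h
  ext m
  rw [coeff_zero]
  exact coeff_eq_zero_of_mem_polyGrading hφ (k := k) (by omega)

namespace FreeData

/-- The part of multidegree `b` of a graded free module. -/
def degPart (G : FreeData n) (𝕜 : Type*) [Field 𝕜] (b : Fin n → ℤ) :
    Submodule 𝕜 (G.Carrier 𝕜) where
  carrier := {v | ∀ g, v g ∈ polyGrading 𝕜 n (b - G.deg g)}
  add_mem' hv hw g := add_mem (hv g) (hw g)
  zero_mem' _ := zero_mem _
  smul_mem' c _ hv g := Submodule.smul_mem _ c (hv g)

/-- The projection of a graded free module onto its part of multidegree `b`. -/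
noncomputable def proj (G : FreeData n) (𝕜 : Type*) [Field 𝕜] (b : Fin n → ℤ) :
    G.Carrier 𝕜 →ₗ[𝕜] G.Carrier 𝕜 where
  toFun v := Finsupp.equivFunOnFinite.symm fun g =>
    weightedHomogeneousComponent (unitWeight n) (b - G.deg g) (v g)
  map_add' v w := by ext1 g; simp
  map_smul' c v := by ext1 g; simp

theorem proj_apply (G : FreeData n) (b : Fin n → ℤ) (v : G.Carrier 𝕜) (g : G.gens) :
    G.proj 𝕜 b v g = weightedHomogeneousComponent (unitWeight n) (b - G.deg g) (v g) := rfl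

theorem proj_mem (G : FreeData n) (b : Fin n → ℤ) (v : G.Carrier 𝕜) :
    G.proj 𝕜 b v ∈ G.degPart 𝕜 b :=
  fun g => weightedHomogeneousComponent_mem _ (v g) _

theorem proj_eq_self {G : FreeData n} {b : Fin n → ℤ} {v : G.Carrier 𝕜}
    (hv : v ∈ G.degPart 𝕜 b) : G.proj 𝕜 b v = v := by
  ext1 g
  exact (hv g).weightedHomogeneousComponent_same

/-- A homogeneous map of degree `0` commutes with the projections to the multidegrees. -/
theorem map_proj {G H : FreeData n}
    (D : G.Carrier 𝕜 →ₗ[MvPolynomial (Fin n) 𝕜] H.Carrier 𝕜)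
    (hD : ∀ g h, D (G.gen 𝕜 g) h ∈ polyGrading 𝕜 n (G.deg g - H.deg h)) (b : Fin n → ℤ)
    (v : G.Carrier 𝕜) : D (G.proj 𝕜 b v) = H.proj 𝕜 b (D v) := by
  classical
  induction v using Finsupp.induction_linear with
  | zero => simp
  | add v w hv hw => rw [map_add, map_add, hv, hw, map_add, map_add]
  | single g φ =>
    induction φ using MvPolynomial.induction_on' with
    | add φ ψ hφ hψ => rw [Finsupp.single_add, map_add, map_add, hφ, hψ, map_add, map_add]
    | monomial u a =>
      have hsingle : ∀ m : MvPolynomial (Fin n) 𝕜, (Finsupp.single g m : G.Carrier 𝕜) =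
          m • G.gen 𝕜 g := fun m => by rw [gen, Finsupp.smul_single, smul_eq_mul, mul_one]
      have hproj : G.proj 𝕜 b (Finsupp.single g (monomial u a)) = Finsupp.single g
          (weightedHomogeneousComponent (unitWeight n) (b - G.deg g) (monomial u a)) := by
        ext1 g'
        rw [proj_apply]
        by_cases hg : g = g'
        · subst hg; simp
        · rw [Finsupp.single_eq_of_ne (Ne.symm hg), Finsupp.single_eq_of_ne (Ne.symm hg), map_zero]
      have hmon := isWeightedHomogeneous_monomial (unitWeight n) u a rfl
      have hprod : ∀ h, IsWeightedHomogeneous (unitWeight n)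
          (monomial u a * D (G.gen 𝕜 g) h)
          (Finsupp.weight (unitWeight n) u + (G.deg g - H.deg h)) :=
        fun h => hmon.mul (hD g h)
      rw [hproj, hsingle, hsingle, map_smul, map_smul]
      ext1 h
      rw [proj_apply, Finsupp.smul_apply, Finsupp.smul_apply, smul_eq_mul, smul_eq_mul]
      by_cases hu : Finsupp.weight (unitWeight n) u = b - G.deg g
      · have h1 := hprod h
        rw [hu] at hmon h1
        rw [hmon.weightedHomogeneousComponent_same]
        rw [show b - G.deg g + (G.deg g - H.deg h) = b - H.deg h by abel] at h1
        rw [h1.weightedHomogeneousComponent_same]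
      · rw [hmon.weightedHomogeneousComponent_ne _ (Ne.symm hu), zero_mul,
          (hprod h).weightedHomogeneousComponent_ne]
        intro h2
        refine hu ?_
        have h3 := congrArg (· - (G.deg g - H.deg h)) h2
        simp only [add_sub_cancel_right] at h3
        rw [← h3]
        abel

/-- The part of multidegree `b` has a basis of monomial multiples of the generators of degree
`≤ b`. -/
noncomputable def degPartEquiv (G : FreeData n) (𝕜 : Type*) [Field 𝕜] (b : Fin n → ℤ) :
    G.degPart 𝕜 b ≃ₗ[𝕜] ({g : G.gens // G.deg g ≤ b} → 𝕜) where
  toFun v g := coeff (expo (b - G.deg g)) (v.1 g)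
  map_add' v w := by ext; simp
  map_smul' c v := by ext; simp
  invFun w := by
    classical
    exact ⟨Finsupp.equivFunOnFinite.symm fun g =>
      if h : G.deg g ≤ b then monomial (expo (b - G.deg g)) (w ⟨g, h⟩) else 0, fun g => by
        change (if h : G.deg g ≤ b then monomial (expo (b - G.deg g)) (w ⟨g, h⟩) else 0) ∈ _
        split_ifs with h
        · exact isWeightedHomogeneous_monomial _ _ _ (weight_expo (sub_nonneg.2 h))
        · exact zero_mem _⟩
  left_inv v := by
    classical
    refine Subtype.ext (Finsupp.ext fun g => ?_)
    change (if h : G.deg g ≤ b then monomial (expo (b - G.deg g))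
      (coeff (expo (b - G.deg g)) (v.1 g)) else 0) = v.1 g
    split_ifs with h
    · exact (eq_monomial_of_mem_polyGrading (v.2 g)).symm
    · exact (eq_zero_of_mem_polyGrading (v.2 g) (fun h' => h (sub_nonneg.1 h'))).symm
  right_inv w := by
    classical
    funext g
    change coeff _ (if h : G.deg g ≤ b then monomial (expo (b - G.deg g)) (w ⟨g, h⟩) else 0) = w g
    rw [dif_pos g.2, coeff_monomial, if_pos rfl]

instance (G : FreeData n) (b : Fin n → ℤ) : FiniteDimensional 𝕜 (G.degPart 𝕜 b) :=
  (G.degPartEquiv 𝕜 b).symm.finiteDimensional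

open Classical in
theorem finrank_degPart (G : FreeData n) (b : Fin n → ℤ) :
    Module.finrank 𝕜 (G.degPart 𝕜 b) = (Finset.univ.filter fun g => G.deg g ≤ b).card := by
  rw [(G.degPartEquiv 𝕜 b).finrank_eq, Module.finrank_fintype_fun_eq_card, Fintype.card_subtype]

end FreeData

/-- The alternating sum of the dimensions in a bounded exact sequence of vector spaces. -/
theorem sum_finrank_eq_zero_of_exact {V : ℕ → Type*} [∀ i, AddCommGroup (V i)]
    [∀ i, Module 𝕜 (V i)] [∀ i, FiniteDimensional 𝕜 (V i)] (D : ∀ i, V (i + 1) →ₗ[𝕜] V i)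
    (h0 : Function.Surjective (D 0)) (hD : ∀ i, LinearMap.ker (D i) = LinearMap.range (D (i + 1)))
    (hn : Module.finrank 𝕜 (V (n + 1)) = 0) :
    ∑ i ∈ Finset.range (n + 1), (-1 : ℤ) ^ i * Module.finrank 𝕜 (V i) = 0 := by
  have hsucc : ∀ i, Module.finrank 𝕜 (V (i + 1)) =
      Module.finrank 𝕜 (LinearMap.range (D i)) + Module.finrank 𝕜 (LinearMap.range (D (i + 1))) := by
    intro i
    rw [← hD i, LinearMap.finrank_range_add_finrank_ker]
  have hzero : Module.finrank 𝕜 (V 0) = Module.finrank 𝕜 (LinearMap.range (D 0)) := by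
    rw [LinearMap.range_eq_top.2 h0, finrank_top]
  have key : ∀ m, ∑ i ∈ Finset.range (m + 1), (-1 : ℤ) ^ i * Module.finrank 𝕜 (V i) =
      (-1) ^ m * Module.finrank 𝕜 (LinearMap.range (D m)) := by
    intro m
    induction m with
    | zero => simp [hzero]
    | succ m ih =>
      rw [Finset.sum_range_succ, ih, hsucc m]
      push_cast
      ring
  have hle := hsucc n
  rw [key n, show Module.finrank 𝕜 (LinearMap.range (D n)) = 0 by omega]
  simp

end Graded

/-! ### Numerical consequences of a resolution of an artinian module -/

section Resolution

variable {𝕜 : Type*} [Field 𝕜] {n : ℕ} {M : Type*} [AddCommGroup M] [Module 𝕜 M]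
  [Module (MvPolynomial (Fin n) 𝕜) M] {𝓜 : (Fin n → ℤ) → Submodule 𝕜 M}

theorem exists_int_forall_le {ι : Type*} [Finite ι] (w : ι → ℤ) : ∃ B : ℤ, ∀ i, w i ≤ B := by
  obtain ⟨B, hB⟩ := (Set.finite_range w).bddAbove
  exact ⟨B, fun i => hB ⟨i, rfl⟩⟩

/-- A resolved artinian module vanishes in all multidegrees with a large `k`-th coordinate: there
its elements are divisible by a power of `X k`, hence, by the descending chain condition, by all
powers of `X k`. -/
theorem exists_forall_degPart_le_range [IsArtinian (MvPolynomial (Fin n) 𝕜) M]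
    (F : MinimalFreeResolution 𝕜 n 𝓜) (k : Fin n) :
    ∃ B : ℤ, ∀ b : Fin n → ℤ, B ≤ b k → ∀ v ∈ (F.term 0).degPart 𝕜 b,
      ∃ u ∈ (F.term 1).degPart 𝕜 b, F.d 0 u = v := by
  classical
  set I : ℕ → Submodule (MvPolynomial (Fin n) 𝕜) M := fun N =>
    LinearMap.range (LinearMap.lsmul (MvPolynomial (Fin n) 𝕜) M (X k ^ N)) with hI
  have hmemI : ∀ N x, x ∈ I N ↔ ∃ y : M, (X k ^ N : MvPolynomial (Fin n) 𝕜) • y = x :=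
    fun N x => Iff.rfl
  have hanti : ∀ N N', N ≤ N' → I N' ≤ I N := by
    intro N N' h x hx
    obtain ⟨y, rfl⟩ := (hmemI _ _).1 hx
    refine (hmemI _ _).2 ⟨(X k ^ (N' - N) : MvPolynomial (Fin n) 𝕜) • y, ?_⟩
    rw [smul_smul, ← pow_add, Nat.add_sub_cancel' h]
  obtain ⟨N, hN⟩ := IsArtinian.monotone_stabilizes
    (⟨fun N => OrderDual.toDual (I N), fun N N' h => hanti N N' h⟩ :
      ℕ →o (Submodule (MvPolynomial (Fin n) 𝕜) M)ᵒᵈ)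
  have hN' : ∀ m, N ≤ m → I N = I m := hN
  obtain ⟨B, hB⟩ := exists_int_forall_le fun g => (F.term 0).deg g k + N
  refine ⟨B, fun b hb v hv => ?_⟩
  -- `v` is divisible by `X k ^ N`
  have hdiv : ∀ g, ∃ t, v g = X k ^ N * t := by
    intro g
    rw [eq_monomial_of_mem_polyGrading (hv g)]
    refine ⟨monomial (expo (b - (F.term 0).deg g) - Finsupp.single k N)
      (coeff (expo (b - (F.term 0).deg g)) (v g)), ?_⟩
    rw [X_pow_eq_monomial, monomial_mul, one_mul, add_tsub_cancel_of_le]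
    rw [Finsupp.single_le_iff, expo_apply, Pi.sub_apply]
    have := hB g
    omega
  choose t ht using hdiv
  set v' : (F.term 0).Carrier 𝕜 := Finsupp.equivFunOnFinite.symm t with hv'
  have hvv' : v = (X k ^ N : MvPolynomial (Fin n) 𝕜) • v' := by
    ext1 g
    exact ht g
  -- its image in `M` is divisible by a still larger power
  obtain ⟨B', hB'⟩ := exists_int_forall_le fun g => b k - (F.term 0).deg g k
  have hmem : F.aug v ∈ I (N + (B'.toNat + 1)) := by
    rw [← hN' _ (by omega), hvv', map_smul]
    exact (hmemI _ _).2 ⟨_, rfl⟩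
  obtain ⟨y, hy⟩ := (hmemI _ _).1 hmem
  obtain ⟨w, rfl⟩ := F.aug_surjective y
  set w' : (F.term 0).Carrier 𝕜 :=
    (X k ^ (N + (B'.toNat + 1)) : MvPolynomial (Fin n) 𝕜) • w with hw'
  have hker : F.aug (v - w') = 0 := by
    rw [map_sub, hw', map_smul, hy, sub_self]
  obtain ⟨u, hu⟩ := (F.exact_zero _).1 hker
  have hproj : (F.term 0).proj 𝕜 b w' = 0 := by
    ext1 g
    rw [FreeData.proj_apply, Finsupp.zero_apply, weightedHomogeneousComponent_eq_zero']
    intro m hm hwt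
    rw [hw', Finsupp.smul_apply, smul_eq_mul, X_pow_eq_monomial, mem_support_iff,
      coeff_monomial_mul'] at hm
    have hle : Finsupp.single k (N + (B'.toNat + 1)) ≤ m := by
      by_contra h
      rw [if_neg h] at hm
      exact hm rfl
    rw [Finsupp.single_le_iff] at hle
    have h1 := congrFun hwt k
    rw [weight_unitWeight, Pi.sub_apply] at h1
    have h2 := hB' g
    omega
  refine ⟨(F.term 1).proj 𝕜 b u, FreeData.proj_mem _ _ _, ?_⟩
  rw [FreeData.map_proj (F.d 0) (F.d_homogeneous 0), hu, map_sub, hproj, sub_zero,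
    FreeData.proj_eq_self hv]

open Classical in
/-- The Euler characteristic of the resolution in the multidegrees in which the module vanishes. -/
theorem exists_forall_sum_card_eq_zero [IsArtinian (MvPolynomial (Fin n) 𝕜) M]
    (F : MinimalFreeResolution 𝕜 n 𝓜) (hF : IsEmpty (F.term (n + 1)).gens) (k : Fin n) :
    ∃ B : ℤ, ∀ b : Fin n → ℤ, B ≤ b k → ∑ i ∈ Finset.range (n + 1),
      (-1 : ℤ) ^ i * (Finset.univ.filter fun g => (F.term i).deg g ≤ b).card = 0 := by
  obtain ⟨B, hB⟩ := exists_forall_degPart_le_range F k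
  refine ⟨B, fun b hb => ?_⟩
  have hmap : ∀ i, ∀ v ∈ (F.term (i + 1)).degPart 𝕜 b, F.d i v ∈ (F.term i).degPart 𝕜 b := by
    intro i v hv
    rw [← FreeData.proj_eq_self hv, FreeData.map_proj _ (F.d_homogeneous i)]
    exact FreeData.proj_mem _ _ _
  have h := sum_finrank_eq_zero_of_exact (𝕜 := 𝕜) (n := n)
    (V := fun i => (F.term i).degPart 𝕜 b)
    (fun i => ((F.d i).restrictScalars 𝕜).restrict (hmap i)) ?_ ?_ ?_
  · rw [← h]
    exact Finset.sum_congr rfl fun i _ => by rw [FreeData.finrank_degPart]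
  · rintro ⟨v, hv⟩
    obtain ⟨u, hu, rfl⟩ := hB b hb v hv
    exact ⟨⟨u, hu⟩, rfl⟩
  · intro i
    ext ⟨v, hv⟩
    rw [LinearMap.mem_ker, LinearMap.mem_range]
    constructor
    · intro h
      obtain ⟨u, hu⟩ := (F.exact_succ i v).1 (congrArg Subtype.val h)
      refine ⟨⟨(F.term (i + 2)).proj 𝕜 b u, FreeData.proj_mem _ _ _⟩, Subtype.ext ?_⟩
      change F.d (i + 1) ((F.term (i + 2)).proj 𝕜 b u) = v
      rw [FreeData.map_proj _ (F.d_homogeneous (i + 1)), hu, FreeData.proj_eq_self hv]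
    · rintro ⟨⟨u, hu⟩, h⟩
      have h1 : F.d (i + 1) u = v := congrArg Subtype.val h
      exact Subtype.ext ((F.exact_succ i v).2 ⟨u, h1⟩)
  · rw [FreeData.finrank_degPart, Finset.univ_eq_empty, Finset.filter_empty, Finset.card_empty]

open Classical in
/-- A finitely supported function on `ℤ^n` whose sums over all lower sets `{q | q ≤ p}` vanish is
zero. -/
theorem eq_zero_of_forall_sum_le_eq_zero {ν : (Fin n → ℤ) →₀ ℤ}
    (h : ∀ p ∈ ν.support, Finsupp.linearCombination ℤ (fun q => if q ≤ p then (1 : ℤ) else 0) ν = 0) :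
    ν = 0 := by
  by_contra hν
  obtain ⟨p, hp⟩ := ν.support.exists_minimal (Finsupp.support_nonempty_iff.2 hν)
  have h1 := h p hp.prop
  rw [Finsupp.linearCombination_apply, Finsupp.sum, Finset.sum_eq_single p] at h1
  · rw [if_pos le_rfl, smul_eq_mul, mul_one] at h1
    exact (Finsupp.mem_support_iff.1 hp.prop) h1
  · intro q hq hqp
    rw [if_neg, smul_zero]
    exact fun hle => hqp (le_antisymm hle (hp.le_of_le hq hle))
  · exact fun hn => absurd hp.prop hn

theorem linearCombination_sum_single {N : ℕ} {ι : ℕ → Type*} [∀ i, Fintype (ι i)] {κ A : Type*}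
    [CommRing A] (q : ∀ i, ι i → κ) (φ : κ → A) :
    Finsupp.linearCombination ℤ φ (∑ i ∈ Finset.range N, ∑ g : ι i,
      Finsupp.single (q i g) ((-1) ^ i)) =
      ∑ i ∈ Finset.range N, (-1 : A) ^ i * ∑ g, φ (q i g) := by
  rw [map_sum]
  refine Finset.sum_congr rfl fun i _ => ?_
  rw [map_sum, Finset.mul_sum]
  refine Finset.sum_congr rfl fun g _ => ?_
  rw [Finsupp.linearCombination_single, zsmul_eq_mul]
  push_cast
  rfl

/-- In the alternating sum of the multidegrees of the generators everything cancels as soon as one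
of the coordinates is forgotten. -/
theorem sum_update_deg_eq_zero [IsArtinian (MvPolynomial (Fin n) 𝕜) M]
    (F : MinimalFreeResolution 𝕜 n 𝓜) (hF : IsEmpty (F.term (n + 1)).gens) (k : Fin n)
    {A : Type*} [CommRing A] (φ : (Fin n → ℤ) → A) :
    ∑ i ∈ Finset.range (n + 1),
      (-1 : A) ^ i * ∑ g, φ (Function.update ((F.term i).deg g) k 0) = 0 := by
  classical
  set ν : (Fin n → ℤ) →₀ ℤ := ∑ i ∈ Finset.range (n + 1), ∑ g : (F.term i).gens,
    Finsupp.single (Function.update ((F.term i).deg g) k 0) ((-1) ^ i) with hν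
  suffices h0 : ν = 0 by
    rw [← linearCombination_sum_single, ← hν, h0, map_zero]
  obtain ⟨B, hB⟩ := exists_forall_sum_card_eq_zero F hF k
  obtain ⟨B', hB'⟩ := exists_int_forall_le
    fun x : Σ i : Fin (n + 1), (F.term i).gens => (F.term x.1).deg x.2 k
  refine eq_zero_of_forall_sum_le_eq_zero fun p _ => ?_
  rw [hν, linearCombination_sum_single]
  by_cases hpk : 0 ≤ p k
  · refine Eq.trans ?_ (hB (Function.update p k (max B B')) (by simp))
    refine Finset.sum_congr rfl fun i hi => ?_
    rw [Finset.sum_boole]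
    congr 3
    ext g
    rw [Finset.mem_filter, Finset.mem_filter]
    refine and_congr_right fun _ => ?_
    have hg : (F.term i).deg g k ≤ B' := hB' ⟨⟨i, Finset.mem_range.1 hi⟩, g⟩
    rw [Pi.le_def, Pi.le_def]
    refine forall_congr' fun k' => ?_
    by_cases hk : k' = k
    · subst hk
      simp only [Function.update_self]
      exact iff_of_true hpk (hg.trans (le_max_right _ _))
    · simp only [Function.update_of_ne hk]
  · refine Finset.sum_eq_zero fun i _ => ?_
    rw [Finset.sum_eq_zero, mul_zero]
    intro g _
    rw [if_neg]
    intro hle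
    have := hle k
    rw [Function.update_self] at this
    exact hpk this

end Resolution

/-! ### Betti diagrams with one total degree in each homological degree -/

section Pure

open MvPolynomial

variable {n : ℕ}

/-- The total Betti numbers of a graded free module whose generators all have total degree `t`. -/
theorem mapDomain_betti_apply (G : FreeData n) {t : ℤ} (ht : ∀ g, ∑ k, G.deg g k = t) (j : ℤ) :
    (G.betti.mapDomain fun a => ∑ k, a k) j = if j = t then Fintype.card G.gens else 0 := by
  have h1 : (G.betti.mapDomain fun a => ∑ k, a k) = Finsupp.single t (Fintype.card G.gens) := by
    rw [FreeData.betti, Finsupp.mapDomain_finsetSum]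
    simp only [Finsupp.mapDomain_single, ht]
    rw [← Finsupp.single_finsetSum]
    simp
  rw [h1, Finsupp.single_apply]
  simp only [eq_comm]

theorem sum_content {μ : YoungDiagram} (T : Tableau n μ) : ∑ k, T.content k = μ.cells.card := by
  classical
  simp only [Tableau.content]
  rw [← Nat.cast_sum, Nat.cast_inj]
  rw [Finset.card_eq_sum_card_fiberwise (s := μ.cells) (t := Finset.range n)
    (f := fun c => T.1 c.1 c.2) (fun c hc => by
      have := T.2 c.1 c.2 hc
      simpa using this), ← Fin.sum_univ_eq_sum_range
    (fun k => (μ.cells.filter fun c => T.1 c.1 c.2 = k).card)]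

theorem card_cells_rowShape (l : Fin n → ℕ) (hl : Antitone l) :
    (rowShape l hl).cells.card = ∑ j, l j := by
  have h : (rowShape l hl).cells = Finset.univ.biUnion fun j : Fin n =>
      (Finset.range (l j)).image fun c => ((j : ℕ), c) := by
    ext ⟨i, c⟩
    rw [YoungDiagram.mem_cells, mem_rowShape]
    simp only [Finset.mem_biUnion, Finset.mem_univ, true_and, Finset.mem_image, Finset.mem_range,
      Prod.mk.injEq]
    constructor
    · rintro ⟨hi, hc⟩
      exact ⟨⟨i, hi⟩, c, hc, rfl, rfl⟩
    · rintro ⟨j, c', hc', rfl, rfl⟩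
      exact ⟨j.2, hc'⟩
  rw [h, Finset.card_biUnion]
  · refine Finset.sum_congr rfl fun j _ => ?_
    rw [Finset.card_image_of_injective _ (Prod.mk_right_injective _), Finset.card_range]
  · intro i _ j _ hij
    rw [Function.onFun, Finset.disjoint_left]
    intro x hx hx'
    obtain ⟨c, -, rfl⟩ := Finset.mem_image.1 hx
    obtain ⟨c', -, h⟩ := Finset.mem_image.1 hx'
    exact hij (Fin.ext (Prod.ext_iff.1 h).1.symm)

theorem card_equivariantTerm (e : Fin n → ℕ) (he : ∀ j, 0 < e j) (i : Fin (n + 1)) :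
    Fintype.card (equivariantTerm e he i).gens = tableauCount (alpha e i) := by
  rw [tableauCount_eq (alpha_antitone e he i), ← Nat.card_eq_fintype_card]
  rfl

theorem sum_deg_frobenius (r : ℕ) (e : Fin n → ℕ) (he : ∀ j, 0 < e j) (i : Fin (n + 1))
    (g : ((equivariantTerm e he i).frobenius r).gens) :
    ∑ k, ((equivariantTerm e he i).frobenius r).deg g k = (r : ℤ) * ∑ j, (alpha e i j : ℤ) := by
  have h1 : ∑ k, ((equivariantTerm e he i).frobenius r).deg g k =
      (r : ℤ) * ∑ k, Tableau.content g k := by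
    rw [Finset.mul_sum]
    rfl
  have h2 : ∑ k, Tableau.content g k = ((rowShape (alpha e i) (alpha_antitone e he i)).cells.card : ℤ) :=
    sum_content g
  rw [h1, h2, card_cells_rowShape]
  push_cast
  rfl

/-! ### Degrees of a pure resolution and the partitions of the equivariant resolution -/

/-- The partial sum `e i + ⋯ + e (n - 1)`. For the differences `e` of the degrees `d` of a pure
resolution it is `d n - d i`. -/
def codegree (e : Fin n → ℕ) (i : Fin (n + 1)) : ℕ :=
  ∑ l : Fin n, if (i : ℕ) ≤ (l : ℕ) then e l else 0

theorem codegree_castSucc (e : Fin n → ℕ) (i : Fin n) :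
    codegree e i.castSucc = codegree e i.succ + e i := by
  have h : ∀ l : Fin n, (if (i.castSucc : ℕ) ≤ (l : ℕ) then e l else 0) =
      (if (i.succ : ℕ) ≤ (l : ℕ) then e l else 0) + if l = i then e l else 0 := by
    intro l
    rw [Fin.val_castSucc, Fin.val_succ]
    rcases lt_trichotomy (i : ℕ) (l : ℕ) with h | h | h
    · have : l ≠ i := fun h' => by rw [h'] at h; exact lt_irrefl _ h
      simp [h.le, this, Nat.succ_le_of_lt h]
    · have : l = i := Fin.ext h.symm
      subst this
      simp
    · have : l ≠ i := fun h' => by rw [h'] at h; exact lt_irrefl _ h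
      have h2 : ¬ ((i : ℕ) ≤ l) := by omega
      have h3 : ¬ ((i : ℕ) + 1 ≤ l) := by omega
      simp [h2, h3, this]
  rw [codegree, Finset.sum_congr rfl fun l _ => h l, Finset.sum_add_distrib]
  simp [codegree]

theorem codegree_last (e : Fin n → ℕ) : codegree e (Fin.last n) = 0 := by
  refine Finset.sum_eq_zero fun l _ => if_neg ?_
  rw [Fin.val_last]
  omega

theorem codegree_strictAnti {e : Fin n → ℕ} (he : ∀ i, 0 < e i) : StrictAnti (codegree e) := by
  refine Fin.strictAnti_iff_succ_lt.2 fun i => ?_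
  rw [codegree_castSucc]
  have := he i
  omega

/-- The exponents of the alternant that belongs to the partition `α(e, i)`. -/
theorem alpha_add_eq_codegree (e : Fin n → ℕ) (he : ∀ j, 0 < e j) (i : Fin (n + 1)) (j : Fin n) :
    alpha e i j + (n - 1 - j) = codegree e (i.succAbove j) := by
  have h1 : (∑ l ∈ Finset.Ioi j, (e l - 1)) + (n - 1 - j) = codegree e j.succ := by
    have h2 : ∑ l ∈ Finset.Ioi j, e l = codegree e j.succ := by
      rw [codegree, ← Finset.sum_filter]
      refine Finset.sum_congr ?_ fun _ _ => rfl
      ext l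
      simp only [Finset.mem_Ioi, Finset.mem_filter, Finset.mem_univ, true_and, Fin.val_succ,
        Fin.lt_def]
      omega
    have h3 : (Finset.Ioi j).card = n - 1 - j := by simp
    rw [← h2, ← h3, Finset.card_eq_sum_ones, ← Finset.sum_add_distrib]
    exact Finset.sum_congr rfl fun l _ => Nat.sub_add_cancel (he l)
  rw [alpha, add_right_comm, h1]
  by_cases hji : (j : ℕ) < (i : ℕ)
  · rw [if_pos hji, Fin.succAbove_of_castSucc_lt _ _ (by rwa [Fin.lt_def, Fin.val_castSucc]),
      codegree_castSucc]
  · rw [if_neg hji, add_zero, Fin.succAbove_of_le_castSucc _ _ (by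
      rw [Fin.le_def, Fin.val_castSucc]; omega)]

theorem sum_alpha_add_codegree (e : Fin n → ℕ) (he : ∀ j, 0 < e j) (i : Fin (n + 1)) :
    ∑ j, alpha e i j + ∑ j : Fin n, (n - 1 - j) + codegree e i = ∑ i, codegree e i := by
  rw [Fin.sum_univ_succAbove _ i, ← Finset.sum_add_distrib,
    Finset.sum_congr rfl fun j _ => alpha_add_eq_codegree e he i j, add_comm]

theorem pure_degree_add_codegree {d : Fin (n + 1) → ℤ} {e : Fin n → ℕ}
    (he : ∀ i : Fin n, d i.succ - d i.castSucc = (e i : ℤ)) (i : Fin (n + 1)) :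
    d i + codegree e i = d (Fin.last n) := by
  induction i using Fin.reverseInduction with
  | last => simp [codegree_last]
  | cast i ih =>
    have h := he i
    rw [codegree_castSucc]
    push_cast
    linarith

theorem codegree_mul (r : ℕ) (e : Fin n → ℕ) (i : Fin (n + 1)) :
    codegree (fun l => r * e l) i = r * codegree e i := by
  simp only [codegree, Finset.mul_sum, mul_ite, mul_zero]

variable {𝕜 : Type*} [Field 𝕜] {M : Type*} [AddCommGroup M] [Module 𝕜 M]
  [Module (MvPolynomial (Fin n) 𝕜) M] {𝓜 : (Fin n → ℤ) → Submodule 𝕜 M}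

/-! ### The equations for the generating functions of a pure resolution -/

/-- The generating function of the multidegrees of the generators, shifted by `L` in each
coordinate. -/
noncomputable def genPoly (G : FreeData n) (L : ℤ) : MvPolynomial (Fin n) ℤ :=
  ∑ g : G.gens, ∏ k, X k ^ (G.deg g k + L).toNat

theorem eval_one_genPoly (G : FreeData n) (L : ℤ) :
    eval (fun _ => 1) (genPoly G L) = (Fintype.card G.gens : ℤ) := by
  simp [genPoly]

/-- A common shift that makes all multidegrees nonnegative, so that polynomials can be used in place
of Laurent polynomials. -/
theorem exists_shift (F : MinimalFreeResolution 𝕜 n 𝓜) :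
    ∃ L : ℤ, ∀ (i : Fin (n + 1)) (g : (F.term i).gens) (k : Fin n),
      0 ≤ (F.term i).deg g k + L := by
  obtain ⟨B, hB⟩ := exists_int_forall_le
    fun x : (Σ i : Fin (n + 1), (F.term i).gens) × Fin n => -(F.term x.1.1).deg x.1.2 x.2
  refine ⟨B, fun i g k => ?_⟩
  have := hB (⟨i, g⟩, k)
  simp only at this
  omega

/-- The equations of the Betti diagram of a pure resolution of an artinian module: the generating
functions are in the kernel of a generalized Vandermonde matrix. -/
theorem sum_pow_codegree_mul_genPoly [IsArtinian (MvPolynomial (Fin n) 𝕜) M]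
    (F : MinimalFreeResolution 𝕜 n 𝓜) {d : Fin (n + 1) → ℤ} (hF : F.IsPure d) {e : Fin n → ℕ}
    (he : ∀ i : Fin n, d i.succ - d i.castSucc = (e i : ℤ)) {L : ℤ}
    (hL : ∀ (i : Fin (n + 1)) (g : (F.term i).gens) (k : Fin n), 0 ≤ (F.term i).deg g k + L)
    (k : Fin n) : ∑ i : Fin (n + 1),
      (-1) ^ (i : ℕ) * (X k ^ codegree e i * genPoly (F.term i) L) = 0 := by
  classical
  have h := sum_update_deg_eq_zero F (hF.2 _ (Nat.lt_succ_self n)) k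
    (fun q => X k ^ (L + d (Fin.last n) - ∑ k', q k').toNat *
      ∏ k' ∈ Finset.univ.erase k, X k' ^ (q k' + L).toNat : (Fin n → ℤ) → MvPolynomial (Fin n) ℤ)
  rw [← Fin.sum_univ_eq_sum_range (fun i => (-1 : MvPolynomial (Fin n) ℤ) ^ i * ∑ g, _)] at h
  rw [← h]
  refine Finset.sum_congr rfl fun i _ => ?_
  rw [genPoly, Finset.mul_sum]
  congr 1
  refine Finset.sum_congr rfl fun g _ => ?_
  rw [← Finset.mul_prod_erase _ _ (Finset.mem_univ k), ← mul_assoc, ← pow_add]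
  congr 1
  · congr 1
    have h1 : ∑ k', Function.update ((F.term i).deg g) k 0 k' = d i - (F.term i).deg g k := by
      rw [← hF.1 i g, ← Finset.add_sum_erase _ _ (Finset.mem_univ k),
        ← Finset.add_sum_erase _ ((F.term i).deg g) (Finset.mem_univ k), Function.update_self,
        zero_add, add_sub_cancel_left]
      exact Finset.sum_congr rfl fun k' hk' =>
        Function.update_of_ne (Finset.ne_of_mem_erase hk') _ _
    have h2 := pure_degree_add_codegree he i
    have h3 := hL i g k
    rw [h1]
    omega
  · exact Finset.prod_congr rfl fun k' hk' => by
      rw [Function.update_of_ne (Finset.ne_of_mem_erase hk')]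

end Pure

end MultigradedBetti

open MultigradedBetti in
theorem corollary1p6 {𝕜 : Type*} [Field 𝕜] [CharZero 𝕜] (n : ℕ)
    -- a `ℤ^n`-graded artinian module `M` over `S = 𝕜[x_1, …, x_n]`
    {M : Type*} [AddCommGroup M] [Module 𝕜 M] [Module (MvPolynomial (Fin n) 𝕜) M]
    [IsScalarTower 𝕜 (MvPolynomial (Fin n) 𝕜) M] [IsArtinian (MvPolynomial (Fin n) 𝕜) M]
    (𝓜 : (Fin n → ℤ) → Submodule 𝕜 M) [DirectSum.Decomposition 𝓜]
    [SetLike.GradedSMul (MultigradedBetti.polyGrading 𝕜 n) 𝓜]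
    -- its minimal resolution becomes pure, of type `d_0 < ⋯ < d_n`, when taking total degrees
    (F : MultigradedBetti.MinimalFreeResolution 𝕜 n 𝓜)
    (d : Fin (n + 1) → ℤ) (hd : StrictMono d) (hF : F.IsPure d)
    -- `e` is the difference vector of `d`, and `e = r • e'` with `r = gcd (e_1, …, e_n)`
    (e e' : Fin n → ℕ) (r : ℕ) (he : ∀ i : Fin n, d i.succ - d i.castSucc = (e i : ℤ))
    (hr : r = Finset.univ.gcd e) (hpos : ∀ i, 0 < e' i) (he' : ∀ i, e i = r * e' i) :
    ∃ m c : ℤ, ∀ (i : Fin (n + 1)) (j : ℤ),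
      (F.bettiDiagram.total i j : ℤ) =
        m * ((MultigradedBetti.equivariantBettiDiagram r e' hpos).total i (j - c) : ℤ) := by
  have htotal : ∀ (i : Fin (n + 1)) (j : ℤ), F.bettiDiagram.total i j =
      if j = d i then Fintype.card (F.term i).gens else 0 :=
    fun i j => mapDomain_betti_apply (F.term i) (hF.1 i) j
  have htotal' : ∀ (i : Fin (n + 1)) (j : ℤ), (equivariantBettiDiagram r e' hpos).total i j =
      if j = (r : ℤ) * ∑ l, (alpha e' i l : ℤ) then tableauCount (alpha e' i) else 0 := by
    intro i j
    rw [← card_equivariantTerm e' hpos]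
    exact mapDomain_betti_apply ((equivariantTerm e' hpos i).frobenius r)
      (sum_deg_frobenius r e' hpos i) j
  have hee : e = fun l => r * e' l := funext he'
  have hcod : ∀ i, codegree e i = r * codegree e' i := fun i => by rw [hee, codegree_mul]
  -- the twist does not depend on the homological degree
  have htwist : ∀ i, d i - (r : ℤ) * ∑ l, (alpha e' i l : ℤ) =
      d 0 - (r : ℤ) * ∑ l, (alpha e' 0 l : ℤ) := by
    have key : ∀ i, d i - (r : ℤ) * ∑ l, (alpha e' i l : ℤ) = d (Fin.last n) +
        r * (∑ j : Fin n, ((n - 1 - j : ℕ) : ℤ)) - r * ∑ i, (codegree e' i : ℤ) := by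
      intro i
      have h1 := pure_degree_add_codegree he i
      have h2 : ((∑ j, alpha e' i j + ∑ j : Fin n, (n - 1 - j) + codegree e' i : ℕ) : ℤ) =
          ((∑ i, codegree e' i : ℕ) : ℤ) := by rw [sum_alpha_add_codegree e' hpos i]
      push_cast at h2
      rw [hcod, Nat.cast_mul] at h1
      linear_combination h1 - r * h2
    exact fun i => (key i).trans (key 0).symm
  -- it remains to compare the ranks
  obtain ⟨m, hm⟩ : ∃ m : ℤ, ∀ i : Fin (n + 1),
      (Fintype.card (F.term i).gens : ℤ) = m * tableauCount (alpha e' i) := by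
    rcases Nat.eq_zero_or_pos n with rfl | hn
    · refine ⟨Fintype.card (F.term 0).gens, fun i => ?_⟩
      rw [tableauCount_zero, Fin.fin_one_eq_zero i]
      simp
    · have he0 : ∀ i, e i ≠ 0 := fun i h0 => by
        have h1 := he i
        have h2 := hd (Fin.castSucc_lt_succ (i := i))
        rw [h0] at h1
        simp only [Nat.cast_zero] at h1
        linarith
      have hr0 : 0 < r := Nat.pos_of_ne_zero fun h0 => he0 ⟨0, hn⟩ (by rw [he', h0, zero_mul])
      have hgcd : ∀ D, (∀ i, D ∣ r * codegree e' i) → D ∣ r := by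
        intro D hD
        rw [hr]
        refine Finset.dvd_gcd fun i _ => ?_
        have h1 := hD i.castSucc
        rw [← hcod, codegree_castSucc, hcod] at h1
        exact (Nat.dvd_add_right (hD i.succ)).1 h1
      obtain ⟨L, hL⟩ := exists_shift F
      obtain ⟨R, hR⟩ := exists_eq_mul_schurValue hr0 (codegree_strictAnti hpos) (codegree_last e')
        hgcd (P := fun i => genPoly (F.term i) L) (fun k => by
          simp only [← hcod]
          exact sum_pow_codegree_mul_genPoly F hF he hL k)
      refine ⟨MvPolynomial.eval (fun _ => 1) R, fun i => ?_⟩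
      rw [← eval_one_genPoly _ L, hR i, map_mul, map_schurValue,
        ← schurValue_one n _ (alpha_antitone e' hpos i)]
      simp [alpha_add_eq_codegree e' hpos]
  refine ⟨m, d 0 - (r : ℤ) * ∑ l, (alpha e' 0 l : ℤ), fun i j => ?_⟩
  rw [htotal, htotal', ← htwist i]
  by_cases hj : j = d i
  · rw [if_pos hj, if_pos (by rw [hj]; ring), hm]
  · rw [if_neg hj, if_neg (fun h => hj (by linarith))]
    simp
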